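/- Let $q\in\mathbb C^\times$ be not a root of unity, $\lambda=q-q^{-1}$. Let $\hat{\mathcal H}_N$ be the affine Hecke algebra: the associative unital $\mathbb C$-algebra generated by $\sigma_1,\dots,\sigma_{N-1},\tau_1,\dots,\tau_N$ with relations $\sigma_i\sigma_{i+1}\sigma_i=\sigma_{i+1}\sigma_i\sigma_{i+1}$, $\sigma_i\sigma_k=\sigma_k\sigma_i$ for $|i-k|>1$, $(\sigma_i-q)(\sigma_i+q^{-1})=0$, $\tau_{j+1}=\sigma_j\tau_j\sigma_j$, $\tau_l\tau_j=\tau_j\tau_l$, and $\tau_j\sigma_i=\sigma_i\tau_j$ for $j\ne i,i+1$. All operators below are taken in an arbitrary $\mathbb C$-algebra $R$ equipped with a homomorphism $\hat{\mathcal H}_N\to R$ (the images of the generators are denoted by the same letters). Put $X_i(x)=\sigma_i+\frac{\lambda x}{1-x}$, and for $\vec w=(w_1,\dots,w_m)$ put $$\vec X_{m,j}(\vec w)=X_j(w_1)X_{j+1}(w_2)\cdots X_{j+m-1}(w_m),\qquad \overleftarrow X_{m,j}(\vec w)=X_{j+m-1}(w_1)X_{j+m-2}(w_2)\cdots X_j(w_m).$$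 Given a boundary element $\tau_1(x)\in R$, put $\tau_j(x)=X_{j-1}(x)\cdots X_1(x)\,\tau_1(x)\,X_1(x)\cdots X_{j-1}(x)$. For a standard Young tableau $\mathcal T_m$ with $m$ nodes, let $\mathcal T_k$ be its subtableau formed by the nodes numbered $1,\dots,k$, let $\alpha_k$ be the node numbered $k$, and let $c_k=c_{\alpha_k}$, where $c_\alpha=q^{2(\mathrm{col}(\alpha)-\mathrm{row}(\alpha))}$ is the quantum content of a node $\alpha$. Let $J_{1,j}=1$, $J_{i+1,j}=\sigma_{j+i-1}J_{i,j}\sigma_{j+i-1}$ be the Jucys–Murphy elements, and let $A_j^{\mathcal T_m}$ be the idempotent defined by $A_j^{\mathcal T_1}=1$ and $$A_j^{\mathcal T_m}=A_j^{\mathcal T_{m-1}}\prod_{\alpha}\frac{J_{m,j}-c_\alpha}{c_m-c_\alpha},$$ the product being over all nodes $\alpha\ne\alpha_m$ that can be added to $\mathcal T_{m-1}$. For tableaux $\mathcal T_m,\mathcal T'_n$ with quantum contents $(c_1,\dots,c_m)$ and $(c'_1,\dots,c'_n)$ define (with $\prod^{\rightarrow}_{i=1\ldots m}f_i=f_1\cdots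 f_m$ and $\prod^{\leftarrow}_{i=1\ldots m}f_i=f_m\cdots f_1$) $$Y_{j,++}^{\mathcal T_m,\mathcal T'_n}(x)=\prod^{\leftarrow}_{i=1\ldots m}\vec X_{n,j+i-1}\big((x\,c_{m-i+1}c'_k)_{k=1}^n\big),\qquad Y_{j,+-}^{\mathcal T_m,\mathcal T'_n}(x)=\prod^{\leftarrow}_{i=1\ldots m}\vec X_{n,j+i-1}\big((x\,c_{m-i+1}/c'_{n-k+1})_{k=1}^n\big),$$ $$Y_{j,-+}^{\mathcal T_m,\mathcal T'_n}(x)=\prod^{\leftarrow}_{i=1\ldots m}\vec X_{n,j+i-1}\big((x\,c'_k/c_i)_{k=1}^n\big),\qquad B_j^{\mathcal T_m}(x)=\prod^{\rightarrow}_{i=1\ldots m}\overleftarrow X_{i-1,j}\big((x^2c_ic_k)_{k=1}^{i-1}\big)\,\tau_j(x c_i),$$ and the projected operators $$\bar B_j^{\mathcal T_m}(x)=A_j^{\mathcal T_m}B_j^{\mathcal T_m}(x),\qquad \bar Y_{j,-+}^{\mathcal T_m,\mathcal T'_n}(x)=A_j^{\mathcal T_m}A_{j+m}^{\mathcal T'_n}Y_{j,-+}^{\mathcal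 T_m,\mathcal T'_n}(x),$$ $$\bar Y_{j,++}^{\mathcal T_m,\mathcal T'_n}(x)=A_{j+m}^{\mathcal T'_n}Y_{j,++}^{\mathcal T_m,\mathcal T'_n}(x),\qquad \bar Y_{j,+-}^{\mathcal T_m,\mathcal T'_n}(x)=Y_{j,+-}^{\mathcal T_m,\mathcal T'_n}(x).$$ **Theorem.** Let $j\ge1$, let $\mathcal T_m,\mathcal T'_n$ be any standard Young tableaux with $j+m+n-1\le N$, and let $x,z\in\mathbb C^\times$ be such that no $X_i$ occurring in the operators below is evaluated at its pole $1$: that is, $xz\,c_ic'_k\ne1$ and $xc_i\ne zc'_k$ for all $i,k$; $x^2c_ic_k\neq1$ and $z^2c'_ic'_k\ne1$ for $k<i$; and, if $j\ge2$, $xc_i\ne1$ and $zc'_k\ne1$. Then the projected fused reflection equation $$\bar Y_{j,-+}^{\mathcal T'_n,\mathcal T_m}(x/z)\,\bar B_j^{\mathcal T_m}(x)\,\bar Y_{j,++}^{\mathcal T_m,\mathcal T'_n}(xz)\,\bar B_j^{\mathcal T'_n}(z)=\bar B_j^{\mathcal T'_n}(z)\,\bar Y_{j,++}^{\mathcal T'_n,\mathcal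 T_m}(xz)\,\bar B_j^{\mathcal T_m}(x)\,\bar Y_{j,+-}^{\mathcal T_m,\mathcal T'_n}(x/z)$$ holds in each of the following two cases: 1. $\tau_1(y)=(\tau_1-\xi y)(\tau_1-\xi y^{-1})^{-1}$ with $\xi\in\mathbb C$ arbitrary, provided that $\tau_1-\xi y^{-1}$ is invertible in $R$ for $y=xc_i$ and $y=zc'_k$ (all $i,k$); 2. $\tau_1(\cdot)$ is any $R$-valued function on a set $D\subseteq\mathbb C$ containing all $xc_i$ and $zc'_k$ that is local ($[\tau_1(y),\sigma_i]=0$ for $2\le i\le N-1$, $y\in D$) and satisfies $X_1(y/w)\tau_1(y)X_1(yw)\tau_1(w)=\tau_1(w)X_1(yw)\tau_1(y)X_1(y/w)$ for all $y,w\in D$ with $w\neq0$, $y\ne w$, $yw\ne1$. -/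

import Mathlib

noncomputable section

/-! ## The affine Hecke algebra -/

/-- Generators: `sigma i` for `1 ≤ i ≤ N - 1` and `tau j` for `1 ≤ j ≤ N`. -/
inductive AffineHeckeGen (N : ℕ) : Type
  | sigma (i : ℕ) (hi : 1 ≤ i ∧ i < N) : AffineHeckeGen N
  | tau (j : ℕ) (hj : 1 ≤ j ∧ j ≤ N) : AffineHeckeGen N

namespace AffineHeckeGen

/-- The generator `σ_i` in the free algebra. -/
abbrev fσ {N : ℕ} (i : ℕ) (hi : 1 ≤ i ∧ i < N) : FreeAlgebra ℂ (AffineHeckeGen N) :=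
  FreeAlgebra.ι ℂ (AffineHeckeGen.sigma i hi)

/-- The generator `τ_j` in the free algebra. -/
abbrev fτ {N : ℕ} (j : ℕ) (hj : 1 ≤ j ∧ j ≤ N) : FreeAlgebra ℂ (AffineHeckeGen N) :=
  FreeAlgebra.ι ℂ (AffineHeckeGen.tau j hj)

end AffineHeckeGen

open AffineHeckeGen in
/-- Defining relations of the affine Hecke algebra.  (Invertibility of the `σ_i` follows from the
quadratic relation when `q ≠ 0`.) -/
inductive AffineHeckeRel (q : ℂ) (N : ℕ) :
    FreeAlgebra ℂ (AffineHeckeGen N) → FreeAlgebra ℂ (AffineHeckeGen N) → Prop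
  | braid (i : ℕ) (hi : 1 ≤ i ∧ i < N) (hi' : 1 ≤ i + 1 ∧ i + 1 < N) :
      AffineHeckeRel q N (fσ i hi * fσ (i + 1) hi' * fσ i hi)
        (fσ (i + 1) hi' * fσ i hi * fσ (i + 1) hi')
  | sigma_comm (i k : ℕ) (hi : 1 ≤ i ∧ i < N) (hk : 1 ≤ k ∧ k < N) (hik : i + 1 < k) :
      AffineHeckeRel q N (fσ i hi * fσ k hk) (fσ k hk * fσ i hi)
  | quadratic (i : ℕ) (hi : 1 ≤ i ∧ i < N) :
      AffineHeckeRel q N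
        ((fσ i hi - algebraMap ℂ _ q) * (fσ i hi + algebraMap ℂ _ q⁻¹)) 0
  | tau_succ (j : ℕ) (hj : 1 ≤ j ∧ j < N) (hj' : 1 ≤ j ∧ j ≤ N)
      (hj'' : 1 ≤ j + 1 ∧ j + 1 ≤ N) :
      AffineHeckeRel q N (fτ (j + 1) hj'') (fσ j hj * fτ j hj' * fσ j hj)
  | tau_comm (l j : ℕ) (hl : 1 ≤ l ∧ l ≤ N) (hj : 1 ≤ j ∧ j ≤ N) :
      AffineHeckeRel q N (fτ l hl * fτ j hj) (fτ j hj * fτ l hl)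
  | tau_sigma (j i : ℕ) (hj : 1 ≤ j ∧ j ≤ N) (hi : 1 ≤ i ∧ i < N) (h1 : j ≠ i)
      (h2 : j ≠ i + 1) :
      AffineHeckeRel q N (fτ j hj * fσ i hi) (fσ i hi * fτ j hj)

/-- The affine Hecke algebra on `N` strands. -/
abbrev AffineHecke (q : ℂ) (N : ℕ) : Type := RingQuot (AffineHeckeRel q N)

namespace AffineHecke

/-- The element `σ_i` (`0` when `i` is out of the range `1 ≤ i ≤ N - 1`). -/
def sigma (q : ℂ) (N : ℕ) (i : ℕ) : AffineHecke q N :=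
  if hi : 1 ≤ i ∧ i < N then RingQuot.mkAlgHom ℂ (AffineHeckeRel q N) (AffineHeckeGen.fσ i hi)
  else 0

/-- The element `τ_j` (`0` when `j` is out of the range `1 ≤ j ≤ N`). -/
def tau (q : ℂ) (N : ℕ) (j : ℕ) : AffineHecke q N :=
  if hj : 1 ≤ j ∧ j ≤ N then RingQuot.mkAlgHom ℂ (AffineHeckeRel q N) (AffineHeckeGen.fτ j hj)
  else 0

end AffineHecke

/-! ## Standard Young tableaux -/

/-- A standard Young tableau with `m` nodes: a Young diagram `shape` whose nodes are filled with
the numbers `1, …, m` (`node a` is the node that contains the number `a + 1`), increasing along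
rows and down columns. A node is a pair (row, column), both counted from `0`. -/
structure StandardTableau (m : ℕ) where
  shape : YoungDiagram
  node : Fin m → ℕ × ℕ
  node_injective : Function.Injective node
  mem_shape_iff : ∀ α : ℕ × ℕ, α ∈ shape ↔ ∃ a, node a = α
  row_increasing : ∀ a b : Fin m, (node a).1 = (node b).1 → (node a).2 < (node b).2 → a < b
  col_increasing : ∀ a b : Fin m, (node a).2 = (node b).2 → (node a).1 < (node b).1 → a < b

namespace StandardTableau

/-- Entries weakly increase in the south-east direction. -/
theorem le_of_node_le {m : ℕ} (T : StandardTableau m) {a b : Fin m}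
    (h : T.node a ≤ T.node b) : a ≤ b := by
  obtain ⟨h1, h2⟩ := h
  have hb : T.node b ∈ T.shape := (T.mem_shape_iff _).2 ⟨b, rfl⟩
  have hc : ((T.node a).1, (T.node b).2) ∈ T.shape :=
    T.shape.isLowerSet (show ((T.node a).1, (T.node b).2) ≤ T.node b from ⟨h1, le_rfl⟩) hb
  obtain ⟨c, hc⟩ := (T.mem_shape_iff _).1 hc
  have hc1 : (T.node c).1 = (T.node a).1 := by rw [hc]
  have hc2 : (T.node c).2 = (T.node b).2 := by rw [hc]
  have hac : a ≤ c := by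
    rcases h2.lt_or_eq with h | h
    · exact (T.row_increasing a c hc1.symm (hc2 ▸ h)).le
    · exact (T.node_injective (Prod.ext hc1.symm (h.trans hc2.symm))).le
  have hcb : c ≤ b := by
    rcases h1.lt_or_eq with h | h
    · exact (T.col_increasing c b hc2 (hc1 ▸ h)).le
    · exact (T.node_injective (Prod.ext (hc1.trans h) hc2)).le
  exact hac.trans hcb

/-- The subtableau obtained by removing the node with the largest number. -/
def init {m : ℕ} (T : StandardTableau (m + 1)) : StandardTableau m where
  shape :=
    { cells := Finset.univ.image fun a : Fin m => T.node a.castSucc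
      isLowerSet := by
        intro α β hβ hα
        simp only [Finset.coe_image, Finset.coe_univ, Set.image_univ, Set.mem_range] at hα ⊢
        obtain ⟨a, rfl⟩ := hα
        have hmem : β ∈ T.shape :=
          T.shape.isLowerSet hβ ((T.mem_shape_iff _).2 ⟨a.castSucc, rfl⟩)
        obtain ⟨b, rfl⟩ := (T.mem_shape_iff _).1 hmem
        have hb : b ≤ a.castSucc := T.le_of_node_le hβ
        have hlt : (b : ℕ) < m := lt_of_le_of_lt (Fin.le_def.1 hb) a.isLt
        exact ⟨⟨b, hlt⟩, rfl⟩ }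
  node := fun a => T.node a.castSucc
  node_injective := fun _ _ h => Fin.castSucc_injective m (T.node_injective h)
  mem_shape_iff := fun α => by simp [← YoungDiagram.mem_cells]
  row_increasing := fun a b h h' => T.row_increasing a.castSucc b.castSucc h h'
  col_increasing := fun a b h h' => T.col_increasing a.castSucc b.castSucc h h'

end StandardTableau

/-- A node is addable to `μ` if it is not in `μ` and adding it gives a Young diagram. -/
def YoungDiagram.IsAddable (μ : YoungDiagram) (α : ℕ × ℕ) : Prop :=
  α ∉ μ ∧ IsLowerSet (insert α (μ : Set (ℕ × ℕ)))

/-- The coordinates of an addable node are at most the number of nodes. -/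
theorem YoungDiagram.IsAddable.le_card {μ : YoungDiagram} {α : ℕ × ℕ} (h : μ.IsAddable α) :
    α.1 ≤ μ.card ∧ α.2 ≤ μ.card := by
  obtain ⟨i, k⟩ := α
  have key : ∀ β : ℕ × ℕ, β ≤ (i, k) → β ≠ (i, k) → β ∈ μ.cells := fun β hβ hne => by
    have := h.2 hβ (Set.mem_insert _ _)
    rcases this with rfl | h'
    · exact absurd rfl hne
    · exact h'
  constructor
  · have hs : ((Finset.range i).image fun a => (a, k)) ⊆ μ.cells := by
      intro β hβ
      obtain ⟨a, ha, rfl⟩ := Finset.mem_image.1 hβ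
      have ha := Finset.mem_range.1 ha
      exact key _ ⟨ha.le, le_rfl⟩ (fun e => by simp at e; omega)
    have := Finset.card_le_card hs
    rwa [Finset.card_image_of_injective _ (fun a b e => (Prod.mk.inj e).1),
      Finset.card_range] at this
  · have hs : ((Finset.range k).image fun a => (i, a)) ⊆ μ.cells := by
      intro β hβ
      obtain ⟨a, ha, rfl⟩ := Finset.mem_image.1 hβ
      have ha := Finset.mem_range.1 ha
      exact key _ ⟨le_rfl, ha.le⟩ (fun e => by simp at e; omega)
    have := Finset.card_le_card hs
    rwa [Finset.card_image_of_injective _ (fun a b e => (Prod.mk.inj e).2),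
      Finset.card_range] at this

/-- A Young diagram has finitely many addable nodes. -/
theorem YoungDiagram.finite_isAddable (μ : YoungDiagram) : {α | μ.IsAddable α}.Finite :=
  (Set.finite_Iic ((μ.card, μ.card) : ℕ × ℕ)).subset fun _ h => h.le_card

/-- The finite set `E₊(μ)` of addable nodes. -/
def YoungDiagram.addable (μ : YoungDiagram) : Finset (ℕ × ℕ) := μ.finite_isAddable.toFinset

/-- The quantum content `q ^ (2 (column - row))` of a node. -/
def quantumContent (q : ℂ) (α : ℕ × ℕ) : ℂ := q ^ (2 * ((α.2 : ℤ) - (α.1 : ℤ)))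

/-- The quantum contents `(c_1, …, c_m)` of a tableau, in the order of its numbering. -/
def StandardTableau.contents (q : ℂ) {m : ℕ} (T : StandardTableau m) (a : Fin m) : ℂ :=
  quantumContent q (T.node a)

/-! ## Operators

From here on `R` is a `ℂ`-algebra and `s i` is the value of `σ_i` in `R`. Vectors
`(u_1, …, u_m)` are functions on `Fin m`, with `u_i` at position `i - 1`; the reversed vector is
`u ∘ Fin.rev`. -/

section Operators

variable {R : Type*} [Ring R] [Algebra ℂ R]

/-- The ordered product `f_1 f_2 ⋯ f_m`. -/
def prodRight {m : ℕ} (f : Fin m → R) : R := (List.ofFn f).prod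

/-- The ordered product `f_m ⋯ f_2 f_1`. -/
def prodLeft {m : ℕ} (f : Fin m → R) : R := (List.ofFn f).reverse.prod

/-- The shifted Jucys–Murphy element `J_{k+1, j}`:
`J_{1,j} = 1`, `J_{k+2,j} = σ_{j+k} J_{k+1,j} σ_{j+k}`. -/
def jucysMurphy (s : ℕ → R) (j : ℕ) : ℕ → R
  | 0 => 1
  | k + 1 => s (j + k) * jucysMurphy s j k * s (j + k)

open Polynomial in
/-- The idempotent `A_j^T`, by recursion on the number of nodes:
`A_j^{T_m} = A_j^{T_{m-1}} ∏ (J_{m,j} - c_α) / (c_m - c_α)`, the product being over the addable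
nodes `α` of `T_{m-1}` other than the node containing `m`. The product of the commuting factors is
formed as a polynomial evaluated at `J_{m,j}`. -/
def idem (q : ℂ) (s : ℕ → R) (j : ℕ) : (m : ℕ) → StandardTableau m → R
  | 0, _ => 1
  | m + 1, T =>
      idem q s j m T.init *
        aeval (jucysMurphy s j m)
          (∏ α ∈ T.init.shape.addable.erase (T.node (Fin.last m)),
            C (quantumContent q (T.node (Fin.last m)) - quantumContent q α)⁻¹ *
              (X - C (quantumContent q α)))

/-- The Baxterized element `X_i(x) = σ_i + λ x / (1 - x)`, `λ = q - q⁻¹` (for `x ≠ 1`). -/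
def bax (q : ℂ) (s : ℕ → R) (i : ℕ) (x : ℂ) : R :=
  s i + algebraMap ℂ R ((q - q⁻¹) * x / (1 - x))

/-- `X_j(u_1) X_{j+1}(u_2) ⋯ X_{j+m-1}(u_m)`. -/
def fwdX (q : ℂ) (s : ℕ → R) {m : ℕ} (j : ℕ) (u : Fin m → ℂ) : R :=
  prodRight fun i : Fin m => bax q s (j + (i : ℕ)) (u i)

/-- `X_{j+m-1}(u_1) X_{j+m-2}(u_2) ⋯ X_j(u_m)`. -/
def bwdX (q : ℂ) (s : ℕ → R) {m : ℕ} (j : ℕ) (u : Fin m → ℂ) : R :=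
  prodRight fun i : Fin m => bax q s (j + (i.rev : ℕ)) (u i)

/-- The Baxterized boundary element (`j ≥ 1`)
`τ_j(x) = X_{j-1}(x) ⋯ X_1(x) τ_1(x) X_1(x) ⋯ X_{j-1}(x)`, with `t x` the value of `τ_1(x)`. -/
def baxTau (q : ℂ) (s : ℕ → R) (t : ℂ → R) (j : ℕ) (x : ℂ) : R :=
  bwdX q s 1 (fun _ : Fin (j - 1) => x) * t x * fwdX q s 1 (fun _ : Fin (j - 1) => x)

/-- The rational solution `τ_1(x) = (τ_1 - ξ x) / (τ_1 - ξ x⁻¹)`, where `τ₁ : R` is the value of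
`τ_1` (for `x ≠ 0` with invertible denominator, which commutes with the numerator). -/
def rationalTau (ξ : ℂ) (τ₁ : R) (x : ℂ) : R :=
  (τ₁ - algebraMap ℂ R (ξ * x)) * Ring.inverse (τ₁ - algebraMap ℂ R (ξ * x⁻¹))

/-- `t` is a boundary element `τ_1(x)`, defined for `x ∈ D`: it is local (it commutes with `σ_i`
for `2 ≤ i ≤ N - 1`) and solves the (unfused) reflection equation
`X_1(x/y) τ_1(x) X_1(xy) τ_1(y) = τ_1(y) X_1(xy) τ_1(x) X_1(x/y)`. -/
structure IsReflectionSolution (q : ℂ) (N : ℕ) (s : ℕ → R) (D : Set ℂ) (t : ℂ → R) : Prop where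
  isLocal : ∀ x ∈ D, ∀ i : ℕ, 2 ≤ i → i < N → Commute (t x) (s i)
  reflection : ∀ x ∈ D, ∀ y ∈ D, y ≠ 0 → x / y ≠ 1 → x * y ≠ 1 →
    bax q s 1 (x / y) * t x * bax q s 1 (x * y) * t y =
      t y * bax q s 1 (x * y) * t x * bax q s 1 (x / y)

/-- The fused operator `Y_{j,++}^{u,v}(x)`. -/
def Ypp (q : ℂ) (s : ℕ → R) {m n : ℕ} (j : ℕ) (u : Fin m → ℂ) (v : Fin n → ℂ) (x : ℂ) : R :=
  prodLeft fun i : Fin m => fwdX q s (j + (i : ℕ)) fun k : Fin n => x * u i.rev * v k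

/-- The fused operator `Y_{j,+-}^{u,v}(x)`. -/
def Ypm (q : ℂ) (s : ℕ → R) {m n : ℕ} (j : ℕ) (u : Fin m → ℂ) (v : Fin n → ℂ) (x : ℂ) : R :=
  prodLeft fun i : Fin m => fwdX q s (j + (i : ℕ)) fun k : Fin n => x * u i.rev / v k.rev

/-- The fused operator `Y_{j,-+}^{u,v}(x)`. -/
def Ymp (q : ℂ) (s : ℕ → R) {m n : ℕ} (j : ℕ) (u : Fin m → ℂ) (v : Fin n → ℂ) (x : ℂ) : R :=
  prodLeft fun i : Fin m => fwdX q s (j + (i : ℕ)) fun k : Fin n => x * v k / u i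

/-- The fused boundary operator
`B_j^u(x) = ∏_{i = 1, …, m} X_{j+i-2}(x² u_i u_1) ⋯ X_j(x² u_i u_{i-1}) τ_j(x u_i)`. -/
def fusedB (q : ℂ) (s : ℕ → R) (t : ℂ → R) {m : ℕ} (j : ℕ) (u : Fin m → ℂ) (x : ℂ) : R :=
  prodRight fun i : Fin m =>
    bwdX q s j (fun k : Fin (i : ℕ) => x ^ 2 * u i * u (k.castLE i.isLt.le)) *
      baxTau q s t j (x * u i)

/-- The fused projected boundary operator `A_j^T B_j^T(x)`. -/
def projB (q : ℂ) (s : ℕ → R) (t : ℂ → R) {m : ℕ} (j : ℕ) (T : StandardTableau m) (x : ℂ) : R :=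
  idem q s j m T * fusedB q s t j (T.contents q) x

/-- The projected operator `A_j^T A_{j+m}^{T'} Y_{j,-+}^{T,T'}(x)`. -/
def projYmp (q : ℂ) (s : ℕ → R) {m n : ℕ} (j : ℕ) (T : StandardTableau m)
    (T' : StandardTableau n) (x : ℂ) : R :=
  idem q s j m T * idem q s (j + m) n T' * Ymp q s j (T.contents q) (T'.contents q) x

/-- The projected operator `A_{j+m}^{T'} Y_{j,++}^{T,T'}(x)`. -/
def projYpp (q : ℂ) (s : ℕ → R) {m n : ℕ} (j : ℕ) (T : StandardTableau m)
    (T' : StandardTableau n) (x : ℂ) : R :=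
  idem q s (j + m) n T' * Ypp q s j (T.contents q) (T'.contents q) x

/-- The operator `Y_{j,+-}^{T,T'}(x)` (no projector is needed). -/
def projYpm (q : ℂ) (s : ℕ → R) {m n : ℕ} (j : ℕ) (T : StandardTableau m)
    (T' : StandardTableau n) (x : ℂ) : R :=
  Ypm q s j (T.contents q) (T'.contents q) x

end Operators

/-- `B_j^T(x)` contains no Baxterized element `X_i` evaluated at its pole `1`. -/
structure RegularB (q : ℂ) {m : ℕ} (j : ℕ) (T : StandardTableau m) (x : ℂ) : Prop where
  pair : ∀ i k : Fin m, k < i → x ^ 2 * T.contents q i * T.contents q k ≠ 1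
  single : 2 ≤ j → ∀ i : Fin m, x * T.contents q i ≠ 1

/-- The operators `Y^{T,T'}(xz)` and `Y^{T,T'}(x/z)` contain no Baxterized element `X_i` evaluated
at its pole `1`. -/
structure RegularY (q : ℂ) {m n : ℕ} (T : StandardTableau m) (T' : StandardTableau n)
    (x z : ℂ) : Prop where
  mul : ∀ (i : Fin m) (k : Fin n), x * z * T.contents q i * T'.contents q k ≠ 1
  div : ∀ (i : Fin m) (k : Fin n), x / z * T.contents q i / T'.contents q k ≠ 1

end

/-! The equation splits into an identity without projectors and absorption rules for the projectors.

Without projectors it holds for arbitrary parameter vectors u, v in place of x c_i and z c'_k, away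
from the poles (`blockReflection_reflection`). It says that two bundles of lines may reflect from
the boundary in either order, and it is proved by moving one line at a time: `yangBaxter` serves at
the crossings, the reflection equation of two single lines (`baxTau_reflection`) at the boundary.
Contents play no role there.

Contents matter for the absorption rules. A row of factors X(x c_i) behind A_{j+1}^T absorbs A_j^T
on its right (`idem_mul_fwdX`), and a column of factors X(y/c_i) behind A_j^T absorbs A_{j+1}^T
(`idem_mul_prodLeft_bax`). Iterated over a whole crossing, these rules remove or create the inner
projectors, and `projected_fused_reflection` assembles the result.

Both rules rest on the fusion formula `idem_mul_prodLeft_bax_eq`: with A_j^T on the left, a column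
collapses to a multiple of (J_{m+1} - y) σ⁻¹⋯σ⁻¹. The factor J_{m+1} - y commutes with A_j^T and the
product of inverses shifts A_{j+1}^T to A_j^T, which is the column rule. A row is inverted by a
column up to a scalar, so the defect of the row rule is an eigenvector of J_{m+1} with eigenvalue
1/x. For generic x there is no such eigenvalue, and special x follow by polynomial continuation.

Since R is arbitrary, neither semisimplicity nor a dimension count is available. The spectrum of
J_{m+1} on vectors with the contents of a standard tableau is derived from the relations alone
(`annihilatesWeight`), by induction with intertwiners.

Case 1 reduces to case 2, because the rational boundary element solves the reflection equation
(`isReflectionSolution_rationalTau`). -/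

noncomputable section

/-- A family satisfying the relations of the finite Hecke algebra on `N` strands. -/
structure IsHeckeFamily {R : Type*} [Ring R] [Algebra ℂ R] (q : ℂ) (N : ℕ) (s : ℕ → R) : Prop where
  quadratic : ∀ i, 1 ≤ i → i < N → s i * s i = (q - q⁻¹) • s i + 1
  braid : ∀ i, 1 ≤ i → i + 1 < N → s i * s (i + 1) * s i = s (i + 1) * s i * s (i + 1)
  comm : ∀ i k, i + 1 < k → Commute (s i) (s k)

/-! ### Relations of the affine Hecke algebra, transported to R -/

section AffineHecke

variable {R : Type*} [Ring R] [Algebra ℂ R] {q : ℂ} {N : ℕ}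

theorem AffineHecke.isHeckeFamily (hq0 : q ≠ 0) (ρ : AffineHecke q N →ₐ[ℂ] R) :
    IsHeckeFamily q N fun i => ρ (AffineHecke.sigma q N i) := by
  refine ⟨fun i h1 h2 => ?_, fun i h1 h2 => ?_, fun i k hik => ?_⟩
  · have h := congrArg ρ (RingQuot.mkAlgHom_rel ℂ (AffineHeckeRel.quadratic (q := q) i ⟨h1, h2⟩))
    simp only [map_mul, map_sub, map_add, AlgHom.commutes, map_zero] at h
    simp only [AffineHecke.sigma, h1, h2, and_self, dif_pos]
    simp only [mul_add, sub_mul, smul_sub, smul_smul, Algebra.algebraMap_eq_smul_one,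
      smul_mul_assoc, one_mul, mul_smul_comm, mul_one] at h
    linear_combination (norm := skip) h
    simp only [inv_mul_cancel₀ hq0]
    module
  · have h := congrArg ρ (RingQuot.mkAlgHom_rel ℂ
      (AffineHeckeRel.braid (q := q) i ⟨h1, by omega⟩ ⟨by omega, h2⟩))
    simp only [map_mul] at h
    simpa [AffineHecke.sigma, h1, h2, show i < N by omega] using h
  · by_cases hi : 1 ≤ i ∧ i < N
    · by_cases hk : 1 ≤ k ∧ k < N
      · have h := congrArg ρ (RingQuot.mkAlgHom_rel ℂ
          (AffineHeckeRel.sigma_comm (q := q) i k hi hk hik))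
        simp only [map_mul] at h
        simpa only [Commute, SemiconjBy, AffineHecke.sigma, hi, hk, dif_pos, and_self] using h
      · simp [AffineHecke.sigma, hk]
    · simp [AffineHecke.sigma, hi]

theorem AffineHecke.tau_one_commute_sigma (ρ : AffineHecke q N →ₐ[ℂ] R) {i : ℕ} (hi : 2 ≤ i) :
    Commute (ρ (AffineHecke.tau q N 1)) (ρ (AffineHecke.sigma q N i)) := by
  by_cases hN : i < N
  · have h := congrArg ρ (RingQuot.mkAlgHom_rel ℂ (AffineHeckeRel.tau_sigma (q := q) 1 i
      ⟨le_rfl, by omega⟩ ⟨by omega, hN⟩ (by omega) (by omega)))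
    simp only [map_mul] at h
    have h1 : 1 ≤ i := by omega
    have h2 : 1 ≤ N := by omega
    simpa only [Commute, SemiconjBy, AffineHecke.tau, AffineHecke.sigma, h1, h2, hN, le_refl,
      and_self, dif_pos] using h
  · simp [AffineHecke.sigma, hN]

theorem AffineHecke.tau_sigma_tau_sigma (ρ : AffineHecke q N →ₐ[ℂ] R) :
    Commute (ρ (AffineHecke.tau q N 1)) (ρ (AffineHecke.sigma q N 1) *
      ρ (AffineHecke.tau q N 1) * ρ (AffineHecke.sigma q N 1)) := by
  by_cases hN : 1 < N
  · have h := congrArg ρ (RingQuot.mkAlgHom_rel ℂ (AffineHeckeRel.tau_comm (q := q) (N := N) 1 2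
      ⟨le_rfl, by omega⟩ ⟨by omega, by omega⟩))
    have h' := congrArg ρ (RingQuot.mkAlgHom_rel ℂ (AffineHeckeRel.tau_succ (q := q) (N := N) 1
      ⟨le_rfl, hN⟩ ⟨le_rfl, by omega⟩ ⟨by omega, by omega⟩))
    simp only [map_mul] at h h'
    rw [h'] at h
    have h2 : 1 ≤ N := by omega
    simpa only [Commute, SemiconjBy, AffineHecke.tau, AffineHecke.sigma, h2, hN, le_refl,
      and_self, dif_pos] using h
  · simp [AffineHecke.sigma, hN]

end AffineHecke

/-! ### Yang–Baxter equation and inversion of Baxterized elements -/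

section Baxterized

variable {R : Type*} [Ring R] [Algebra ℂ R] {q : ℂ} {N : ℕ} {s : ℕ → R}

theorem bax_eq (q : ℂ) (s : ℕ → R) (i : ℕ) (x : ℂ) :
    bax q s i x = s i + ((q - q⁻¹) * x / (1 - x)) • (1 : R) := by
  rw [bax, Algebra.algebraMap_eq_smul_one]

theorem Commute.bax_right {y : R} {i : ℕ} (h : Commute y (s i)) (x : ℂ) :
    Commute y (bax q s i x) :=
  h.add_right (Algebra.commutes _ _).symm

/-- After expansion with the quadratic and braid relations, the two sides differ by (lβ + βγ + αβ -
αγ)(A - B), which `h` kills. -/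
theorem add_smul_one_yangBaxter {A B : R} {l α β γ : ℂ} (hA : A * A = l • A + 1)
    (hB : B * B = l • B + 1) (hAB : A * B * A = B * A * B)
    (h : l * β + β * γ + α * β = α * γ) :
    (A + α • (1 : R)) * (B + β • (1 : R)) * (A + γ • (1 : R)) =
      (B + γ • (1 : R)) * (A + β • (1 : R)) * (B + α • (1 : R)) := by
  simp only [mul_add, add_mul, mul_smul_comm, smul_mul_assoc, mul_one, one_mul, hAB, hA, hB]
  match_scalars <;> first | ring1 | linear_combination h | linear_combination -h

namespace IsHeckeFamily

variable (H : IsHeckeFamily q N s)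
include H

theorem comm_of_ne {i k : ℕ} (h : i + 1 < k ∨ k + 1 < i) : Commute (s i) (s k) :=
  h.elim (H.comm i k) fun h => (H.comm k i h).symm

/-- The Yang–Baxter equation. -/
theorem yangBaxter {i : ℕ} (hi : 1 ≤ i) (hN : i + 1 < N) {a b c : ℂ} (hc : c = a * b)
    (ha : a ≠ 1) (hb : b ≠ 1) (hab : c ≠ 1) :
    bax q s i a * bax q s (i + 1) c * bax q s i b =
      bax q s (i + 1) b * bax q s i c * bax q s (i + 1) a := by
  subst hc
  simp only [bax_eq]
  refine add_smul_one_yangBaxter (H.quadratic i hi (by omega)) (H.quadratic _ (by omega) hN)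
    (H.braid i hi hN) ?_
  have ha' := sub_ne_zero.2 ha.symm
  have hb' := sub_ne_zero.2 hb.symm
  have hab' := sub_ne_zero.2 hab.symm
  field_simp
  ring

/-- The scalar may vanish. Fusion only needs the product to be a scalar, never a genuine inverse. -/
theorem bax_mul_bax_inv {i : ℕ} (hi : 1 ≤ i) (hN : i < N) {a : ℂ} (ha0 : a ≠ 0) (ha : a ≠ 1) :
    bax q s i a⁻¹ * bax q s i a = (1 - (q - q⁻¹) ^ 2 * a / (1 - a) ^ 2) • (1 : R) := by
  have ha' := sub_ne_zero.2 ha.symm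
  have e : (q - q⁻¹) * a⁻¹ / (1 - a⁻¹) = -((q - q⁻¹) / (1 - a)) := by
    have : 1 - a⁻¹ ≠ 0 := by
      rw [sub_ne_zero, ne_eq, eq_comm, inv_eq_one]; exact ha
    have h2 : a - 1 ≠ 0 := sub_ne_zero.2 ha
    field_simp
    ring
  simp only [bax_eq, e]
  simp only [mul_add, add_mul, mul_smul_comm, smul_mul_assoc, mul_one, one_mul,
    H.quadratic i hi hN]
  match_scalars <;> field_simp <;> ring

end IsHeckeFamily
end Baxterized

/-! ### Jucys–Murphy elements and their intertwiners -/

section JucysMurphyIntertwine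

variable {R : Type*} [Ring R] {s : ℕ → R} {j : ℕ}

/-- Two families and two base indices are allowed so that one statement covers both commutation and
the index shift effected by `sigmaInvProd`. -/
theorem jucysMurphy_intertwine {s' : ℕ → R} {j' : ℕ} {V : R} {k : ℕ}
    (h : ∀ i < k, V * s' (j' + i) = s (j + i) * V) :
    V * jucysMurphy s' j' k = jucysMurphy s j k * V := by
  induction k with
  | zero => simp [jucysMurphy]
  | succ k ih =>
    have e := h k (by omega)
    have ih := ih fun i hi => h i (by omega)
    simp only [jucysMurphy]
    rw [← mul_assoc, ← mul_assoc, e, mul_assoc (s _) V, ih, mul_assoc, mul_assoc _ V, e]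
    simp only [mul_assoc]

theorem Commute.jucysMurphy_right {y : R} {k : ℕ} (h : ∀ i < k, Commute y (s (j + i))) :
    Commute y (jucysMurphy s j k) :=
  jucysMurphy_intertwine h

end JucysMurphyIntertwine

section JucysMurphy

variable {R : Type*} [Ring R] [Algebra ℂ R] {q : ℂ} {N : ℕ} {s : ℕ → R} {j : ℕ}

namespace IsHeckeFamily

variable (H : IsHeckeFamily q N s)
include H

theorem commute_jucysMurphy_of_gt {i k : ℕ} (h : k < i) :
    Commute (s (j + i)) (jucysMurphy s j k) :=
  Commute.jucysMurphy_right fun _ _ => H.comm_of_ne (by omega)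

theorem commute_jucysMurphy_of_lt (hj : 1 ≤ j) {k : ℕ} (hN : j + k ≤ N) {i : ℕ}
    (h : i + 1 < k) : Commute (s (j + i)) (jucysMurphy s j k) := by
  induction k with
  | zero => omega
  | succ k ih =>
    rcases Nat.lt_or_ge (i + 1) k with hk | hk
    · have h1 := ih (by omega) hk
      have h2 : Commute (s (j + i)) (s (j + k)) := H.comm_of_ne (by omega)
      exact (h2.mul_right h1).mul_right h2
    -- In the boundary case the element is b a J a b, and a passes through it by the braid relation
    -- once on each side of J, which commutes with b.
    · obtain rfl : k = i + 1 := by omega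
      have hb := H.braid (j + i) (by omega) (by omega)
      have hc : Commute (s (j + (i + 1))) (jucysMurphy s j i) :=
        H.commute_jucysMurphy_of_gt (by omega)
      simp only [jucysMurphy]
      rw [add_assoc] at hb
      set a := s (j + i)
      set b := s (j + (i + 1))
      set J := jucysMurphy s j i
      show a * (b * (a * J * a) * b) = b * (a * J * a) * b * a
      calc a * (b * (a * J * a) * b) = (a * b * a) * J * a * b := by simp only [mul_assoc]
        _ = b * a * (b * J) * a * b := by rw [hb]; simp only [mul_assoc]
        _ = b * a * J * (b * a * b) := by rw [hc.eq]; simp only [mul_assoc]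
        _ = _ := by rw [← hb]; simp only [mul_assoc]

theorem jucysMurphy_commute_of_le (hj : 1 ≤ j) {k l : ℕ} (hN : j + l ≤ N) (h : k ≤ l) :
    Commute (jucysMurphy s j k) (jucysMurphy s j l) := by
  rcases h.eq_or_lt with rfl | h
  · exact Commute.refl _
  · exact (Commute.jucysMurphy_right fun i hi =>
      (H.commute_jucysMurphy_of_lt hj hN (by omega)).symm).symm

/-- `σ J_k = J_{k+1} (σ - λ)`. -/
theorem sigma_mul_jucysMurphy (hj : 1 ≤ j) {k : ℕ} (hN : j + k < N) :
    s (j + k) * jucysMurphy s j k =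
      jucysMurphy s j (k + 1) * s (j + k) - (q - q⁻¹) • jucysMurphy s j (k + 1) := by
  have h := H.quadratic (j + k) (by omega) hN
  simp only [jucysMurphy]
  rw [mul_assoc (s (j + k) * _) (s (j + k)) (s (j + k)), h]
  simp only [mul_add, mul_smul_comm, mul_one]
  abel

/-- `σ J_{k+1} = J_k σ + λ J_{k+1}`. -/
theorem sigma_mul_jucysMurphy_succ (hj : 1 ≤ j) {k : ℕ} (hN : j + k < N) :
    s (j + k) * jucysMurphy s j (k + 1) =
      jucysMurphy s j k * s (j + k) + (q - q⁻¹) • jucysMurphy s j (k + 1) := by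
  have h := H.quadratic (j + k) (by omega) hN
  simp only [jucysMurphy]
  rw [← mul_assoc, ← mul_assoc, h]
  simp only [add_mul, smul_mul_assoc, one_mul]
  abel

end IsHeckeFamily

/-- The intertwiner `σ (J_k - J_{k+1}) + λ J_{k+1}` between the eigenspaces of `J_k` and
`J_{k+1}`. -/
def jmIntertwiner (q : ℂ) (s : ℕ → R) (j k : ℕ) : R :=
  s (j + k) * (jucysMurphy s j k - jucysMurphy s j (k + 1)) +
    (q - q⁻¹) • jucysMurphy s j (k + 1)

theorem Commute.jmIntertwiner_right {y : R} {k : ℕ} (h : ∀ i ≤ k, Commute y (s (j + i))) :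
    Commute y (jmIntertwiner q s j k) := by
  have h1 : Commute y (jucysMurphy s j k) := .jucysMurphy_right fun i hi => h i hi.le
  have h2 : Commute y (jucysMurphy s j (k + 1)) := .jucysMurphy_right fun i hi => h i (by omega)
  exact ((h k le_rfl).mul_right (h1.sub_right h2)).add_right (h2.smul_right _)

namespace IsHeckeFamily

variable (H : IsHeckeFamily q N s)
include H

theorem jmIntertwiner_mul_jucysMurphy (hj : 1 ≤ j) {k : ℕ} (hN : j + k < N) :
    jmIntertwiner q s j k * jucysMurphy s j k =
      jucysMurphy s j (k + 1) * jmIntertwiner q s j k := by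
  have h1 := H.sigma_mul_jucysMurphy hj hN
  have hc := (H.jucysMurphy_commute_of_le hj (show j + (k + 1) ≤ N by omega) (Nat.le_succ k)).eq
  simp only [jmIntertwiner]
  set J := jucysMurphy s j k
  set K := jucysMurphy s j (k + 1)
  set g := s (j + k)
  set l := q - q⁻¹
  have e : g * (J - K) * J = (K * g - l • K) * (J - K) := by
    rw [← h1]; simp only [mul_assoc, sub_mul, mul_sub, hc]
  rw [add_mul, e]
  simp only [mul_add, mul_sub, sub_mul, smul_mul_assoc, mul_smul_comm, mul_assoc]
  module

theorem jmIntertwiner_mul_jucysMurphy_succ (hj : 1 ≤ j) {k : ℕ} (hN : j + k < N) :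
    jmIntertwiner q s j k * jucysMurphy s j (k + 1) =
      jucysMurphy s j k * jmIntertwiner q s j k := by
  have h1 := H.sigma_mul_jucysMurphy_succ hj hN
  have hc := (H.jucysMurphy_commute_of_le hj (show j + (k + 1) ≤ N by omega) (Nat.le_succ k)).eq
  simp only [jmIntertwiner]
  set J := jucysMurphy s j k
  set K := jucysMurphy s j (k + 1)
  set g := s (j + k)
  set l := q - q⁻¹
  have e : g * (J - K) * K = (J * g + l • K) * (J - K) := by
    rw [← h1]; simp only [mul_assoc, sub_mul, mul_sub, hc]
  rw [add_mul, e]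
  simp only [mul_add, add_mul, mul_sub, smul_mul_assoc, mul_smul_comm, mul_assoc, hc]
  module

/-- On a joint eigenvector with eigenvalues a, b the square is a scalar, nonzero unless a/b is q² or
q⁻². This is what makes the intertwiner injective. -/
theorem jmIntertwiner_mul_self (hq0 : q ≠ 0) (hj : 1 ≤ j) {k : ℕ} (hN : j + k < N) :
    jmIntertwiner q s j k * jmIntertwiner q s j k =
      -((jucysMurphy s j k - q ^ 2 • jucysMurphy s j (k + 1)) *
        (jucysMurphy s j k - (q ^ 2)⁻¹ • jucysMurphy s j (k + 1))) := by
  have h1 := H.sigma_mul_jucysMurphy hj hN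
  have h2 := H.sigma_mul_jucysMurphy_succ hj hN
  have h3 := H.quadratic (j + k) (by omega) hN
  have h4 := H.jmIntertwiner_mul_jucysMurphy_succ hj hN
  have hc := (H.jucysMurphy_commute_of_le hj (show j + (k + 1) ≤ N by omega) (Nat.le_succ k)).eq
  have hF : jmIntertwiner q s j k * s (j + k) = jucysMurphy s j (k + 1) - jucysMurphy s j k -
      (q - q⁻¹) • (jucysMurphy s j k * s (j + k)) := by
    simp only [jmIntertwiner, mul_sub, h1, h2, sub_mul, add_mul, smul_mul_assoc, mul_assoc, h3,
      mul_add, mul_smul_comm, mul_one]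
    module
  have e : jmIntertwiner q s j k * jmIntertwiner q s j k =
      jmIntertwiner q s j k * s (j + k) * (jucysMurphy s j k - jucysMurphy s j (k + 1)) +
      (q - q⁻¹) • (jucysMurphy s j k * jmIntertwiner q s j k) := by
    rw [← h4]
    nth_rw 2 [jmIntertwiner]
    simp only [mul_add, mul_smul_comm, mul_assoc]
  rw [e, hF, jmIntertwiner]
  simp only [mul_add, mul_sub, sub_mul, smul_mul_assoc, mul_smul_comm, mul_assoc, hc, neg_sub,
    smul_sub]
  match_scalars <;> field_simp <;> ring

end IsHeckeFamily

end JucysMurphy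
end

noncomputable section

open Polynomial

/-! ### Quantum contents separate diagonals when q is not a root of unity -/

section QuantumContent

variable {q : ℂ}

theorem zpow_eq_zpow_iff_of_not_root_of_unity (hq0 : q ≠ 0) (hq : ∀ k : ℕ, 0 < k → q ^ k ≠ 1)
    {a b : ℤ} : q ^ a = q ^ b ↔ a = b := by
  refine ⟨fun h => ?_, fun h => h ▸ rfl⟩
  have key : ∀ a b : ℤ, q ^ a = q ^ b → a ≤ b := fun a b h => by
    by_contra hlt
    refine hq (a - b).toNat (by omega) ?_
    rw [← zpow_natCast, Int.toNat_of_nonneg (by omega), zpow_sub₀ hq0, h,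
      div_self (zpow_ne_zero _ hq0)]
  exact le_antisymm (key _ _ h) (key _ _ h.symm)

theorem quantumContent_ne_zero (hq0 : q ≠ 0) (α : ℕ × ℕ) : quantumContent q α ≠ 0 :=
  zpow_ne_zero _ hq0

theorem quantumContent_eq_iff (hq0 : q ≠ 0) (hq : ∀ k : ℕ, 0 < k → q ^ k ≠ 1) {α β : ℕ × ℕ} :
    quantumContent q α = quantumContent q β ↔ α.2 + β.1 = β.2 + α.1 := by
  rw [quantumContent, quantumContent, zpow_eq_zpow_iff_of_not_root_of_unity hq0 hq]
  omega

theorem quantumContent_eq_sq_mul_iff (hq0 : q ≠ 0) (hq : ∀ k : ℕ, 0 < k → q ^ k ≠ 1)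
    {α β : ℕ × ℕ} :
    quantumContent q α = q ^ 2 * quantumContent q β ↔ α.2 + β.1 = β.2 + α.1 + 1 := by
  rw [quantumContent, quantumContent, ← zpow_natCast, ← zpow_add₀ hq0,
    zpow_eq_zpow_iff_of_not_root_of_unity hq0 hq]
  push_cast
  omega

end QuantumContent

/-! ### Standard tableaux as lists of nodes, and addable nodes -/

section StandardList

/-- `α` can be added to the set of nodes in `l`. -/
def AddableTo (α : ℕ × ℕ) (l : List (ℕ × ℕ)) : Prop :=
  α ∉ l ∧ (∀ r, α.1 = r + 1 → (r, α.2) ∈ l) ∧ ∀ c, α.2 = c + 1 → (α.1, c) ∈ l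

/-- The nodes of a standard tableau, listed in decreasing order of their entries. -/
def IsStandardList : List (ℕ × ℕ) → Prop
  | [] => True
  | α :: l => AddableTo α l ∧ IsStandardList l

variable {l l' : List (ℕ × ℕ)} {α β γ : ℕ × ℕ}

theorem AddableTo.mono (h : AddableTo α l) (hl : ∀ γ ∈ l, γ ∈ l') (hα : α ∉ l') :
    AddableTo α l' :=
  ⟨hα, fun r e => hl _ (h.2.1 r e), fun c e => hl _ (h.2.2 c e)⟩

theorem AddableTo.mem_of_lt_of_isLowerSet (h : AddableTo α l)
    (hl : ∀ γ δ, δ ∈ l → γ ≤ δ → γ ∈ l) (hγ : γ ≤ α) (hne : γ ≠ α) : γ ∈ l := by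
  obtain ⟨a, b⟩ := α
  obtain ⟨c, d⟩ := γ
  obtain ⟨h1, h2⟩ := Prod.mk_le_mk.1 hγ
  rcases h1.lt_or_eq with h1 | rfl
  · obtain ⟨r, rfl⟩ : ∃ r, a = r + 1 := ⟨a - 1, by omega⟩
    exact hl _ _ (h.2.1 r rfl) (Prod.mk_le_mk.2 ⟨by omega, h2⟩)
  · have : d ≠ b := fun e => hne (by rw [e])
    obtain ⟨r, rfl⟩ : ∃ r, b = r + 1 := ⟨b - 1, by omega⟩
    exact hl _ _ (h.2.2 r rfl) (Prod.mk_le_mk.2 ⟨le_rfl, by omega⟩)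

theorem IsStandardList.mem_of_le (h : IsStandardList l) :
    ∀ γ δ, δ ∈ l → γ ≤ δ → γ ∈ l := by
  induction l with
  | nil => simp
  | cons α l ih =>
    intro γ δ hδ hγ
    rcases List.mem_cons.1 hδ with rfl | hδ
    · by_cases e : γ = δ
      · simp [e]
      · exact List.mem_cons_of_mem _ (h.1.mem_of_lt_of_isLowerSet (ih h.2) hγ e)
    · exact List.mem_cons_of_mem _ (ih h.2 _ _ hδ hγ)

theorem AddableTo.mem_of_lt (h : AddableTo α l) (hl : IsStandardList l) (hγ : γ ≤ α)
    (hne : γ ≠ α) : γ ∈ l :=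
  h.mem_of_lt_of_isLowerSet hl.mem_of_le hγ hne

theorem AddableTo.eq_of_le (hα : AddableTo α l) (hγ : AddableTo γ l) (hl : IsStandardList l)
    (h : γ ≤ α) : γ = α := by
  by_contra hne
  exact hγ.1 (hα.mem_of_lt hl h hne)

/-- Nodes on equal or neighbouring diagonals are comparable in the product order, whereas the
addable nodes form an antichain. -/
theorem AddableTo.eq_of_diagonal (hα : AddableTo α l) (hγ : AddableTo γ l)
    (hl : IsStandardList l) (h1 : α.2 + γ.1 ≤ γ.2 + α.1 + 1) (h2 : γ.2 + α.1 ≤ α.2 + γ.1 + 1) :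
    γ = α := by
  by_cases h : γ ≤ α
  · exact hα.eq_of_le hγ hl h
  · refine (hγ.eq_of_le hα hl ?_).symm
    rw [Prod.le_def] at h ⊢
    omega

theorem finite_addableTo (l : List (ℕ × ℕ)) : {α | AddableTo α l}.Finite := by
  refine (((Set.finite_singleton (0, 0)).union
    (l.finite_toSet.image fun p => (p.1 + 1, p.2))).union
    (l.finite_toSet.image fun p => (p.1, p.2 + 1))).subset ?_
  rintro ⟨a, b⟩ h
  rcases a with _ | a
  · rcases b with _ | b
    · simp
    · exact Or.inr ⟨_, h.2.2 b rfl, rfl⟩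
  · exact Or.inl (Or.inr ⟨_, h.2.1 a rfl, rfl⟩)

/-- The quantum contents of the nodes that can be added to `l`. -/
def addableContents (q : ℂ) (l : List (ℕ × ℕ)) : Finset ℂ :=
  (finite_addableTo l).toFinset.image (quantumContent q)

theorem mem_addableContents {q : ℂ} {μ : ℂ} :
    μ ∈ addableContents q l ↔ ∃ α, AddableTo α l ∧ quantumContent q α = μ := by
  simp [addableContents]

end StandardList

/-! ### Polynomials in one element and their eigenvectors -/

section Polynomial

variable {R : Type*} [Ring R] [Algebra ℂ R]

theorem mul_aeval_of_mul_eq {x y V : R} (h : V * x = y * V) (p : ℂ[X]) :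
    V * aeval x p = aeval y p * V := by
  induction p using Polynomial.induction_on with
  | C a => simp [Algebra.commutes]
  | add p r hp hr => simp [mul_add, add_mul, hp, hr]
  | monomial n a ih =>
    rw [pow_succ, ← mul_assoc, map_mul, map_mul (aeval y), aeval_X, aeval_X, ← mul_assoc, ih,
      mul_assoc, h, mul_assoc]

theorem Commute.aeval_right {x y : R} (h : Commute y x) (p : ℂ[X]) : Commute y (aeval x p) :=
  mul_aeval_of_mul_eq h p

theorem aeval_mul_of_eigenvector {x w : R} {μ : ℂ} (h : x * w = μ • w) (p : ℂ[X]) :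
    aeval x p * w = p.eval μ • w := by
  induction p using Polynomial.induction_on with
  | C a => simp [Algebra.smul_def]
  | add p r hp hr => simp [add_mul, add_smul, hp, hr]
  | monomial n a ih =>
    rw [pow_succ, ← mul_assoc, map_mul, aeval_X, mul_assoc, h, mul_smul_comm, ih, eval_mul_X,
      smul_smul, mul_comm]

/-- Roots of an annihilating polynomial without eigenvectors can be discarded. -/
theorem aeval_prod_mul_eq_zero_of_no_eigenvector {x : R} {M : R → Prop}
    (hM : ∀ v, M v → ∀ p : ℂ[X], M (aeval x p * v)) {S S' : Finset ℂ} {v : R} (hv : M v)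
    (hS : aeval x (∏ μ ∈ S, (X - C μ)) * v = 0)
    (h : ∀ ν ∈ S, ν ∉ S' → ∀ w, M w → x * w = ν • w → w = 0) :
    aeval x (∏ μ ∈ S', (X - C μ)) * v = 0 := by
  classical
  induction S using Finset.induction_on generalizing S' v with
  | empty =>
    have : v = 0 := by simpa using hS
    simp [this]
  | insert ν S hν ih =>
    rw [Finset.prod_insert hν] at hS
    by_cases hν' : ν ∈ S'
    · rw [← Finset.prod_erase_mul _ _ hν', map_mul, mul_assoc]
      refine ih (hM v hv _) ?_ fun ν' h1 h2 => h ν' (Finset.mem_insert_of_mem h1) fun h3 =>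
        h2 (Finset.mem_erase.2 ⟨fun e => hν (e ▸ h1), h3⟩)
      rwa [← mul_assoc, ← map_mul, mul_comm]
    · refine ih hv (h ν (Finset.mem_insert_self _ _) hν' _ (hM v hv _) ?_) fun ν' h1 h2 =>
        h ν' (Finset.mem_insert_of_mem h1) h2
      rw [map_mul, mul_assoc, map_sub, aeval_X, aeval_C, sub_mul, sub_eq_zero] at hS
      rw [hS, Algebra.smul_def]

end Polynomial

/-! ### Spectrum of the Jucys–Murphy elements on weight vectors -/

section Weight

variable {R : Type*} [Ring R] [Algebra ℂ R] {q : ℂ} {N : ℕ} {s : ℕ → R} {j : ℕ}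

/-- `v` is a joint eigenvector of the Jucys–Murphy elements, with the quantum contents of the
nodes of `l` as eigenvalues. -/
def IsWeightVector (q : ℂ) (s : ℕ → R) (j : ℕ) : List (ℕ × ℕ) → R → Prop
  | [], _ => True
  | α :: l, v => jucysMurphy s j l.length * v = quantumContent q α • v ∧ IsWeightVector q s j l v

variable {l l' : List (ℕ × ℕ)} {α β γ : ℕ × ℕ} {u v : R}

theorem IsWeightVector.mul_left (h : IsWeightVector q s j l v)
    (hu : ∀ k < l.length, Commute u (jucysMurphy s j k)) : IsWeightVector q s j l (u * v) := by
  induction l with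
  | nil => trivial
  | cons α l ih =>
    refine ⟨?_, ih h.2 fun k hk => hu k (hk.trans (Nat.lt_succ_self _))⟩
    rw [← mul_assoc, ← (hu _ (Nat.lt_succ_self _)).eq, mul_assoc, h.1, mul_smul_comm]

theorem IsWeightVector.mul_right (h : IsWeightVector q s j l v) (y : R) :
    IsWeightVector q s j l (v * y) := by
  induction l with
  | nil => trivial
  | cons α l ih => exact ⟨by rw [← mul_assoc, h.1, smul_mul_assoc], ih h.2⟩

/-- For contents with ratio q² or q⁻² the scalar becomes q or -q⁻¹, the two eigenvalues of σ. -/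
theorem sigma_mul_of_jmIntertwiner_mul_eq_zero {k : ℕ} {a b : ℂ}
    (ha : jucysMurphy s j k * v = a • v) (hb : jucysMurphy s j (k + 1) * v = b • v) (hab : a ≠ b)
    (h : jmIntertwiner q s j k * v = 0) : s (j + k) * v = ((q - q⁻¹) * b / (b - a)) • v := by
  rw [jmIntertwiner, add_mul, mul_assoc, sub_mul, ha, hb, ← sub_smul, mul_smul_comm,
    smul_mul_assoc, hb, smul_smul] at h
  have e : s (j + k) * v = (a - b)⁻¹ • ((a - b) • (s (j + k) * v)) := by
    rw [smul_smul, inv_mul_cancel₀ (sub_ne_zero.2 hab), one_smul]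
  rw [e, eq_neg_of_add_eq_zero_left h, ← neg_smul, smul_smul]
  congr 1
  have h1 := sub_ne_zero.2 hab
  have h2 := sub_ne_zero.2 hab.symm
  field_simp
  ring

namespace IsHeckeFamily

variable (H : IsHeckeFamily q N s)
include H

theorem isWeightVector_jucysMurphy_mul (hj : 1 ≤ j) {k : ℕ} (hk : l.length ≤ k) (hN : j + k ≤ N)
    (h : IsWeightVector q s j l v) (p : ℂ[X]) :
    IsWeightVector q s j l (aeval (jucysMurphy s j k) p * v) :=
  h.mul_left fun i hi =>
    ((H.jucysMurphy_commute_of_le hj hN (show i ≤ k by omega)).aeval_right p).symm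

theorem isWeightVector_jmIntertwiner_mul (hj : 1 ≤ j) (hN : j + l.length < N)
    (h : IsWeightVector q s j l v) :
    IsWeightVector q s j l (jmIntertwiner q s j l.length * v) :=
  h.mul_left fun k hk => by
    have h1 := H.jucysMurphy_commute_of_le hj (show j + l.length ≤ N by omega) hk.le
    have h2 := H.jucysMurphy_commute_of_le hj (show j + (l.length + 1) ≤ N by omega)
      (show k ≤ l.length + 1 by omega)
    have h3 : Commute (s (j + l.length)) (jucysMurphy s j k) := H.commute_jucysMurphy_of_gt hk
    exact ((h3.mul_left (h1.symm.sub_left h2.symm)).add_left (h2.symm.smul_left _))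

theorem eq_zero_of_jmIntertwiner_mul_eq_zero (hq0 : q ≠ 0) (hj : 1 ≤ j) {k : ℕ} (hN : j + k < N)
    {a b : ℂ} (ha : jucysMurphy s j k * v = a • v) (hb : jucysMurphy s j (k + 1) * v = b • v)
    (h1 : a ≠ q ^ 2 * b) (h2 : b ≠ q ^ 2 * a) (h : jmIntertwiner q s j k * v = 0) : v = 0 := by
  have e : jmIntertwiner q s j k * jmIntertwiner q s j k * v = 0 := by rw [mul_assoc, h, mul_zero]
  rw [H.jmIntertwiner_mul_self hq0 hj hN, neg_mul, neg_eq_zero, mul_assoc] at e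
  simp only [sub_mul, smul_mul_assoc, ha, hb, mul_sub, mul_smul_comm, smul_smul, ← sub_smul] at e
  refine (smul_eq_zero.1 e).resolve_left ?_
  have h2' : a - (q ^ 2)⁻¹ * b ≠ 0 := by
    rw [sub_ne_zero]
    rintro rfl
    exact h2 (by field_simp)
  exact fun e => mul_ne_zero (sub_ne_zero.2 h1) h2' (by linear_combination e)

/-- A removable node can be moved to the last position. -/
theorem exists_move_last (hq0 : q ≠ 0) (hq : ∀ k : ℕ, 0 < k → q ^ k ≠ 1) (hj : 1 ≤ j)
    (hN : j + l.length ≤ N) (hl : IsStandardList l) (hβ : β ∈ l) (h1 : (β.1 + 1, β.2) ∉ l)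
    (h2 : (β.1, β.2 + 1) ∉ l) :
    ∃ l' u, IsStandardList (β :: l') ∧ (∀ γ, γ ∈ β :: l' ↔ γ ∈ l) ∧
      (β :: l').length = l.length ∧
      (∀ y, (∀ i, i + 1 < l.length → Commute y (s (j + i))) → Commute y u) ∧
      ∀ v, IsWeightVector q s j l v →
        IsWeightVector q s j (β :: l') (u * v) ∧ (u * v = 0 → v = 0) := by
  induction l with
  | nil => simp at hβ
  | cons α l ih =>
    by_cases hαβ : β = α
    · subst hαβ
      exact ⟨l, 1, hl, fun _ => Iff.rfl, rfl, fun y _ => Commute.one_right y, fun v hv => by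
        simpa using hv⟩
    have hβl : β ∈ l := by simpa [hαβ] using hβ
    simp only [List.length_cons] at hN
    -- By induction β is moved to the end of l; one more intertwiner then exchanges it with α.
    obtain ⟨l', u, hl', hmem, hlen, hu, hv⟩ := ih (by omega) hl.2 hβl
      (fun h => h1 (List.mem_cons_of_mem _ h)) (fun h => h2 (List.mem_cons_of_mem _ h))
    have hlen' : l.length = l'.length + 1 := hlen.symm
    have hαl' : AddableTo α l' := by
      refine ⟨fun h => hl.1.1 ((hmem _).1 (List.mem_cons_of_mem _ h)), fun r e => ?_,
        fun c e => ?_⟩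
      · refine (List.mem_cons.1 ((hmem _).2 (hl.1.2.1 r e))).resolve_left ?_
        rintro rfl
        exact h1 (by simp [← e])
      · refine (List.mem_cons.1 ((hmem _).2 (hl.1.2.2 c e))).resolve_left ?_
        rintro rfl
        exact h2 (by simp [← e])
    refine ⟨α :: l', jmIntertwiner q s j l'.length * u,
      ⟨hl'.1.mono (fun γ h => List.mem_cons_of_mem _ h) ?_, hαl', hl'.2⟩, ?_, ?_, ?_, ?_⟩
    · rw [List.mem_cons, not_or]
      exact ⟨hαβ, hl'.1.1⟩
    · intro γ
      rw [List.mem_cons, List.mem_cons, List.mem_cons, ← hmem, List.mem_cons]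
      tauto
    · simpa using hlen
    · intro y hy
      refine (Commute.jmIntertwiner_right fun i hi => hy i ?_).mul_right
        (hu y fun i hi => hy i ?_)
      · simp only [List.length_cons]; omega
      · simp only [List.length_cons]; omega
    · intro v hw
      have hJ : Commute (jucysMurphy s j l.length) u := hu _ fun i hi =>
        (H.commute_jucysMurphy_of_lt hj (by omega) hi).symm
      obtain ⟨hw1, hw2⟩ := hv v hw.2
      have ea : jucysMurphy s j (l'.length + 1) * (u * v) = quantumContent q α • (u * v) := by
        rw [← hlen', ← mul_assoc, hJ.eq, mul_assoc, hw.1, mul_smul_comm]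
      refine ⟨⟨?_, ?_, ?_⟩, fun h => hw2 ?_⟩
      · rw [List.length_cons, mul_assoc, ← mul_assoc, ← H.jmIntertwiner_mul_jucysMurphy hj
          (by omega), mul_assoc, hw1.1, mul_smul_comm]
      · rw [mul_assoc, ← mul_assoc, ← H.jmIntertwiner_mul_jucysMurphy_succ hj (by omega),
          mul_assoc, ea, mul_smul_comm]
      · rw [mul_assoc]
        exact H.isWeightVector_jmIntertwiner_mul hj (by omega) hw1.2
      · rw [mul_assoc] at h
        -- Contents with ratio q² or q⁻² would put α and β on neighbouring diagonals, hence make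
        -- them comparable. Then either α already lies in l or β has a neighbour to the right or
        -- below, contrary to its being a corner.
        refine H.eq_zero_of_jmIntertwiner_mul_eq_zero hq0 hj (by omega) hw1.1 ea ?_ ?_ h
        · rw [ne_eq, quantumContent_eq_sq_mul_iff hq0 hq]
          intro e
          by_cases hle : α.1 ≤ β.1
          · exact hl.1.1 (hl.2.mem_of_le _ _ hβl (Prod.le_def.2 ⟨hle, by omega⟩))
          · exact h1 (hl.mem_of_le _ _ List.mem_cons_self
              (Prod.le_def.2 ⟨by dsimp only; omega, by dsimp only; omega⟩))
        · rw [ne_eq, quantumContent_eq_sq_mul_iff hq0 hq]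
          intro e
          by_cases hle : α.2 ≤ β.2
          · exact hl.1.1 (hl.2.mem_of_le _ _ hβl (Prod.le_def.2 ⟨by omega, hle⟩))
          · exact h2 (hl.mem_of_le _ _ List.mem_cons_self
              (Prod.le_def.2 ⟨by dsimp only; omega, by dsimp only; omega⟩))

/-- The Jucys–Murphy element `J_{n+1}` acts on the weight vectors of `l` with eigenvalues the
quantum contents of the addable nodes. -/
def _root_.AnnihilatesWeight (q : ℂ) (s : ℕ → R) (j : ℕ) (l : List (ℕ × ℕ)) : Prop :=
  ∀ v, IsWeightVector q s j l v →
    aeval (jucysMurphy s j l.length) (∏ μ ∈ addableContents q l, (X - C μ)) * v = 0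

omit H in
theorem _root_.AnnihilatesWeight.eq_zero (h : AnnihilatesWeight q s j l)
    (hv : IsWeightVector q s j l v) {μ : ℂ} (hμ : jucysMurphy s j l.length * v = μ • v)
    (hS : μ ∉ addableContents q l) : v = 0 := by
  have := h v hv
  rw [aeval_mul_of_eigenvector hμ, eval_prod] at this
  refine (smul_eq_zero.1 this).resolve_left (Finset.prod_ne_zero_iff.2 fun ν hν => ?_)
  simpa [sub_eq_zero] using fun e : μ = ν => hS (e ▸ hν)

/-- The content sequence b, a, b with b = p² a is impossible. Once β is moved next to α, the two
neighbouring generators act by p and -p⁻¹ on one vector, which contradicts the braid relation unless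
p² = -1. The parameter p is q or -q⁻¹, so one argument serves a column neighbour and a row
neighbour. -/
theorem eq_zero_of_adjacent (hq0 : q ≠ 0) (hq : ∀ k : ℕ, 0 < k → q ^ k ≠ 1) (hj : 1 ≤ j)
    (hN : j + l.length < N) (hl : IsStandardList l) (hα : AddableTo α l) (hβ : β ∈ l)
    (h1 : (β.1 + 1, β.2) ∉ l) (h2 : (β.1, β.2 + 1) ∉ l)
    (hαβ : α = (β.1 + 1, β.2) ∨ α = (β.1, β.2 + 1)) {p : ℂ} (hp : p ≠ 0) (hp1 : p ^ 2 ≠ 1)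
    (hp2 : p ^ 2 ≠ -1) (hpq : p - p⁻¹ = q - q⁻¹)
    (hc : quantumContent q β = p ^ 2 * quantumContent q α)
    (IH : ∀ l' : List (ℕ × ℕ), l'.length ≤ l.length → IsStandardList l' →
      AnnihilatesWeight q s j l')
    (hv : IsWeightVector q s j (α :: l) v)
    (hJ : jucysMurphy s j (l.length + 1) * v = quantumContent q β • v) : v = 0 := by
  obtain ⟨l', u, hl', hmem, hlen, hu, hu'⟩ :=
    H.exists_move_last (l := l) hq0 hq hj (by omega) hl hβ h1 h2
  have hlen' : l.length = l'.length + 1 := hlen.symm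
  have ha := quantumContent_ne_zero hq0 α
  set a := quantumContent q α with ha_def
  have hne : a ≠ p ^ 2 * a := fun e => hp1 (mul_right_cancel₀ ha (by rw [← e, one_mul]))
  have hp1' : p ^ 2 - 1 ≠ 0 := sub_ne_zero.2 hp1
  -- This vector has the contents of l followed by that of β. Since β's diagonal neighbours that of
  -- the addable node α, no addable node of l has this content.
  have hφ : jmIntertwiner q s j l.length * v = 0 := by
    refine (IH l le_rfl hl).eq_zero (H.isWeightVector_jmIntertwiner_mul hj hN hv.2)
      (μ := quantumContent q β) ?_ ?_
    · rw [← mul_assoc, ← H.jmIntertwiner_mul_jucysMurphy_succ hj hN, mul_assoc, hJ,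
        mul_smul_comm]
    · rw [mem_addableContents]
      rintro ⟨γ, hγ, e⟩
      rw [quantumContent_eq_iff hq0 hq] at e
      have := hα.eq_of_diagonal hγ hl (by rcases hαβ with rfl | rfl <;> dsimp only <;> omega)
        (by rcases hαβ with rfl | rfl <;> dsimp only <;> omega)
      subst this
      rcases hαβ with rfl | rfl <;> dsimp only at e <;> omega
  rw [hc] at hJ
  have hg := sigma_mul_of_jmIntertwiner_mul_eq_zero hv.1 hJ hne hφ
  have hcoef : (q - q⁻¹) * (p ^ 2 * a) / (p ^ 2 * a - a) = p := by
    have : p ^ 2 * a - a ≠ 0 := sub_ne_zero.2 hne.symm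
    rw [← hpq]
    field_simp
  rw [hcoef] at hg
  obtain ⟨hw, hw0⟩ := hu' v hv.2
  have hJu : Commute (jucysMurphy s j l.length) u := hu _ fun i hi =>
    (H.commute_jucysMurphy_of_lt hj (by omega) hi).symm
  have hgu : Commute (s (j + l.length)) u := hu _ fun i hi => H.comm_of_ne (by omega)
  have hJ' : jucysMurphy s j (l'.length + 1) * (u * v) = a • (u * v) := by
    rw [← hlen', ← mul_assoc, hJu.eq, mul_assoc, hv.1, mul_smul_comm]
  have hg' : s (j + l.length) * (u * v) = p • (u * v) := by
    rw [← mul_assoc, hgu.eq, mul_assoc, hg, mul_smul_comm]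
  refine hw0 ?_
  -- Here the contents of l' are followed by that of α. The node α cannot be added to l' because its
  -- neighbour β is missing, and no other node of its diagonal can be added either.
  have hφ' : jmIntertwiner q s j l'.length * (u * v) = 0 := by
    refine (IH l' (by omega) hl'.2).eq_zero
      (H.isWeightVector_jmIntertwiner_mul hj (by omega) hw.2) (μ := a) ?_ ?_
    · rw [← mul_assoc, ← H.jmIntertwiner_mul_jucysMurphy_succ hj (by omega), mul_assoc, hJ',
        mul_smul_comm]
    · rw [mem_addableContents]
      rintro ⟨γ, hγ, e⟩
      rw [ha_def, quantumContent_eq_iff hq0 hq] at e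
      have hsub : ∀ δ ∈ l', δ ∈ l := fun δ hδ => (hmem δ).1 (List.mem_cons_of_mem _ hδ)
      have hβl' : β ∉ l' := hl'.1.1
      by_cases hγα : γ = α
      · subst hγα
        rcases hαβ with rfl | rfl
        · exact hβl' (hγ.2.1 _ rfl)
        · exact hβl' (hγ.2.2 _ rfl)
      · by_cases hle : γ ≤ α
        · have := (List.mem_cons.1 ((hmem _).2 (hα.mem_of_lt hl hle hγα))).resolve_right hγ.1
          subst this
          rcases hαβ with rfl | rfl <;> dsimp only at e <;> omega
        · refine hα.1 (hsub _ (hγ.mem_of_lt hl'.2 ?_ (Ne.symm hγα)))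
          rw [Prod.le_def] at hle ⊢
          omega
  have hw1 := hw.1
  rw [hc] at hw1
  have hg'' := sigma_mul_of_jmIntertwiner_mul_eq_zero hw1 hJ' hne.symm hφ'
  have hcoef' : (q - q⁻¹) * a / (a - p ^ 2 * a) = -p⁻¹ := by
    have : a - p ^ 2 * a ≠ 0 := sub_ne_zero.2 hne
    have : 1 - p ^ 2 ≠ 0 := sub_ne_zero.2 hp1.symm
    rw [← hpq]
    field_simp
    ring
  rw [hcoef'] at hg''
  -- The two sides of the braid relation act by p⁻¹ and -p.
  have hb := H.braid (j + l'.length) (by omega) (by omega)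
  rw [add_assoc, ← hlen'] at hb
  have hb' := congrArg (· * (u * v)) hb
  simp only [mul_assoc, hg', hg'', mul_smul_comm, smul_smul] at hb'
  rw [← sub_eq_zero, ← sub_smul] at hb'
  refine (smul_eq_zero.1 hb').resolve_left fun e => hp2 ?_
  field_simp at e
  linear_combination e

/-- Write J, K for the last two Jucys–Murphy elements and a for the content of α. The intertwiner φ
carries K to J, so induction gives φ P(K) v = 0 with P the polynomial of l. Applying φ once more and
using the formula for φ² shows that (K - q⁻² a)(K - q² a) P(K) kills v. The roots that are not
contents addable to α :: l are then discarded, since they have no eigenvectors. -/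
theorem annihilatesWeight (hq0 : q ≠ 0) (hq : ∀ k : ℕ, 0 < k → q ^ k ≠ 1) (hj : 1 ≤ j)
    (hN : j + l.length ≤ N) (hl : IsStandardList l) : AnnihilatesWeight q s j l := by
  induction hn : l.length using Nat.strong_induction_on generalizing l with
  | _ n IH =>
  subst hn
  rcases l with _ | ⟨α, l⟩
  · intro v _
    -- The corner (0, 0) has content 1, so the factor X - 1 is present and vanishes at J₁ = 1.
    have : 1 ∈ addableContents q [] :=
      mem_addableContents.2 ⟨(0, 0), ⟨by simp, by simp, by simp⟩, by simp [quantumContent]⟩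
    rw [← Finset.mul_prod_erase _ _ this, mul_comm, map_mul]
    simp [jucysMurphy]
  intro v hv
  simp only [List.length_cons] at hN IH ⊢
  have IH' : ∀ l' : List (ℕ × ℕ), l'.length ≤ l.length → IsStandardList l' →
      AnnihilatesWeight q s j l' := fun l' h1 h2 => IH l'.length (by omega) (by omega) h2 rfl
  obtain ⟨hα, hl⟩ := hl
  have hN' : j + l.length < N := by omega
  have ha := quantumContent_ne_zero hq0 α
  set a := quantumContent q α with ha_def
  have hq2 : q ^ 2 ≠ 0 := pow_ne_zero _ hq0
  have hq4 : q ^ 4 ≠ 1 := hq 4 (by norm_num)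
  have hq21 : q ^ 2 ≠ 1 := hq 2 (by norm_num)
  have hq2m : q ^ 2 ≠ -1 := fun e => hq4 (by linear_combination (q ^ 2 - 1) * e)
  have hnotin : ∀ β : ℕ × ℕ, β.2 + α.1 = α.2 + β.1 + 1 ∨ α.2 + β.1 = β.2 + α.1 + 1 →
      quantumContent q β ∉ addableContents q l := by
    rintro β h hm
    obtain ⟨γ, hγ, e⟩ := mem_addableContents.1 hm
    rw [quantumContent_eq_iff hq0 hq] at e
    have := hα.eq_of_diagonal hγ hl (by omega) (by omega)
    subst this
    omega
  have e1 : q ^ 2 * a = quantumContent q (α.1, α.2 + 1) :=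
    ((quantumContent_eq_sq_mul_iff hq0 hq).2 (by dsimp only; omega)).symm
  have e2 : (q ^ 2)⁻¹ * a = quantumContent q (α.1 + 1, α.2) := by
    rw [inv_mul_eq_iff_eq_mul₀ hq2]
    exact (quantumContent_eq_sq_mul_iff hq0 hq).2 (by dsimp only; omega)
  have hn1 : q ^ 2 * a ∉ addableContents q l := e1 ▸ hnotin _ (Or.inl (by dsimp only; omega))
  have hn2 : (q ^ 2)⁻¹ * a ∉ insert (q ^ 2 * a) (addableContents q l) := by
    rw [Finset.mem_insert, not_or]
    refine ⟨fun e => hq4 ?_, e2 ▸ hnotin _ (Or.inr (by dsimp only; omega))⟩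
    have := mul_right_cancel₀ ha e
    field_simp at this
    exact this.symm
  refine aeval_prod_mul_eq_zero_of_no_eigenvector (M := IsWeightVector q s j (α :: l))
    (S := insert ((q ^ 2)⁻¹ * a) (insert (q ^ 2 * a) (addableContents q l)))
    (fun v hv p => H.isWeightVector_jucysMurphy_mul hj (by simp) (by omega) hv p) hv ?_ ?_
  · rw [Finset.prod_insert hn2, Finset.prod_insert hn1]
    have h0 := IH' l le_rfl hl _ (H.isWeightVector_jmIntertwiner_mul hj hN' hv.2)
    rw [← mul_assoc, ← mul_aeval_of_mul_eq (H.jmIntertwiner_mul_jucysMurphy_succ hj hN'),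
      mul_assoc] at h0
    set P := ∏ μ ∈ addableContents q l, (X - C μ)
    have hw := H.isWeightVector_jucysMurphy_mul (l := α :: l) hj (by simp) (by omega) hv
      (k := l.length + 1) P
    rw [map_mul (aeval _) (X - C ((q ^ 2)⁻¹ * a)), map_mul (aeval _) (X - C (q ^ 2 * a)),
      mul_assoc, mul_assoc]
    set w := aeval (jucysMurphy s j (l.length + 1)) P * v
    have h1 : jmIntertwiner q s j l.length * jmIntertwiner q s j l.length * w = 0 := by
      rw [mul_assoc, h0, mul_zero]
    have hw1 := hw.1
    have hcom := (H.jucysMurphy_commute_of_le hj (show j + (l.length + 1) ≤ N by omega)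
      (Nat.le_succ l.length)).eq
    rw [H.jmIntertwiner_mul_self hq0 hj hN', neg_mul, neg_eq_zero] at h1
    simp only [map_sub, aeval_X, aeval_C, Algebra.algebraMap_eq_smul_one, sub_mul,
      smul_mul_assoc, one_mul, mul_sub, mul_smul_comm, smul_sub, smul_smul]
    simp only [sub_mul, smul_mul_assoc, mul_sub, mul_smul_comm, smul_sub, smul_smul, hcom,
      mul_assoc, hw1, ← ha_def] at h1
    linear_combination (norm := skip) h1
    match_scalars <;> field_simp <;> ring
  · intro ν hν hν' w hw hJ
    have hJS : ∀ γ, AddableTo γ (α :: l) → quantumContent q γ ≠ ν :=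
      fun γ hγ e => hν' (mem_addableContents.2 ⟨γ, hγ, e⟩)
    simp only [Finset.mem_insert] at hν
    rcases hν with rfl | rfl | hν
    -- The root q⁻² a is the content of the node below α. If that node cannot be added, the node to
    -- the left of α is a corner of l with the same content.
    · have hnot : ¬ AddableTo (α.1 + 1, α.2) (α :: l) := fun h => hJS _ h e2.symm
      have hnl : (α.1 + 1, α.2) ∉ l := fun h =>
        hα.1 (hl.mem_of_le _ _ h (Prod.le_def.2 ⟨by simp, le_rfl⟩))
      obtain ⟨c, hc, hc'⟩ : ∃ c, α.2 = c + 1 ∧ (α.1 + 1, c) ∉ l := by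
        by_contra! hcon
        refine hnot ⟨?_, fun r e => ?_, fun c e => List.mem_cons_of_mem _ (hcon c e)⟩
        · rw [List.mem_cons, not_or]
          exact ⟨fun e => by simpa using congrArg Prod.fst e, hnl⟩
        · obtain rfl : α.1 = r := by simpa using e
          exact List.mem_cons_self
      refine H.eq_zero_of_adjacent (β := (α.1, c)) hq0 hq hj hN' hl hα (hα.2.2 c hc) hc'
        (by rw [← hc]; exact hα.1) (Or.inr (by rw [← hc])) (p := -q⁻¹) (by simpa using hq0)
        ?_ ?_ (by simp; ring) ?_ IH' hw ?_
      · rw [neg_sq, inv_pow]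
        simpa using hq21
      · rw [neg_sq, inv_pow]
        intro e
        rw [inv_eq_iff_eq_inv] at e
        exact hq2m (by rw [e]; norm_num)
      · rw [neg_sq, inv_pow, e2, quantumContent_eq_iff hq0 hq]
        dsimp only; omega
      · rw [hJ, e2]
        congr 1
        rw [quantumContent_eq_iff hq0 hq]
        dsimp only; omega
    -- The transposed case: the root q² a belongs to the node to the right of α, and the obstructing
    -- corner is the node above α.
    · have hnot : ¬ AddableTo (α.1, α.2 + 1) (α :: l) := fun h => hJS _ h e1.symm
      have hnl : (α.1, α.2 + 1) ∉ l := fun h =>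
        hα.1 (hl.mem_of_le _ _ h (Prod.le_def.2 ⟨le_rfl, by simp⟩))
      obtain ⟨r, hr, hr'⟩ : ∃ r, α.1 = r + 1 ∧ (r, α.2 + 1) ∉ l := by
        by_contra! hcon
        refine hnot ⟨?_, fun r e => List.mem_cons_of_mem _ (hcon r e), fun c e => ?_⟩
        · rw [List.mem_cons, not_or]
          exact ⟨fun e => by simpa using congrArg Prod.snd e, hnl⟩
        · obtain rfl : α.2 = c := by simpa using e
          exact List.mem_cons_self
      refine H.eq_zero_of_adjacent (β := (r, α.2)) hq0 hq hj hN' hl hα (hα.2.1 r hr)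
        (by rw [← hr]; exact hα.1) hr' (Or.inl (by rw [← hr])) hq0 hq21 hq2m rfl ?_ IH' hw ?_
      · rw [quantumContent_eq_sq_mul_iff hq0 hq]
        dsimp only; omega
      · rw [hJ, e1]
        congr 1
        rw [quantumContent_eq_iff hq0 hq]
        dsimp only; omega
    · obtain ⟨β, hβ, rfl⟩ := mem_addableContents.1 hν
      by_cases hβα : β = α
      swap
      · refine absurd rfl (hJS β (hβ.mono (fun γ h => List.mem_cons_of_mem _ h) ?_))
        rw [List.mem_cons, not_or]
        exact ⟨hβα, hβ.1⟩
      subst hβα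
      -- Here the remaining root is a itself, so both J and K act on w by a. Then (J - a) σ w = -λ a
      -- w, a Jordan block unless w = 0. Induction excludes it, because a is a simple root of the
      -- polynomial of l.
      have hgw : IsWeightVector q s j l (s (j + l.length) * w) :=
        hw.2.mul_left fun k hk => H.commute_jucysMurphy_of_gt hk
      have h0 := IH' l le_rfl hl _ hgw
      have hy : (jucysMurphy s j l.length - algebraMap ℂ R a) * (s (j + l.length) * w) =
          (-((q - q⁻¹) * a)) • w := by
        have e := congrArg (· * w) (H.sigma_mul_jucysMurphy_succ hj hN')
        simp only [add_mul, mul_assoc, hJ, smul_mul_assoc, mul_smul_comm, smul_smul] at e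
        rw [sub_mul, ← Algebra.smul_def, e]
        module
      rw [← Finset.prod_erase_mul _ _ hν, map_mul, mul_assoc, map_sub, aeval_X, aeval_C, hy,
        mul_smul_comm, aeval_mul_of_eigenvector hw.1, smul_smul, eval_prod] at h0
      refine (smul_eq_zero.1 h0).resolve_left (mul_ne_zero (neg_ne_zero.2 (mul_ne_zero ?_ ha))
        (Finset.prod_ne_zero_iff.2 fun μ hμ => ?_))
      · intro e
        field_simp at e
        exact hq21 (by linear_combination e)
      · simpa [sub_eq_zero] using fun e => (Finset.mem_erase.1 hμ).1 e.symm

end IsHeckeFamily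

end Weight
end

noncomputable section

open Polynomial

/-! ### Recursions for ordered products -/

section OrderedProducts

variable {R : Type*} [Ring R]

theorem prodRight_succ {m : ℕ} (f : Fin (m + 1) → R) :
    prodRight f = prodRight (fun i : Fin m => f i.castSucc) * f (Fin.last m) := by
  rw [prodRight, List.ofFn_succ', List.concat_eq_append, List.prod_append, List.prod_singleton,
    prodRight]

theorem prodLeft_succ {m : ℕ} (f : Fin (m + 1) → R) :
    prodLeft f = f (Fin.last m) * prodLeft fun i : Fin m => f i.castSucc := by
  rw [prodLeft, List.ofFn_succ', List.concat_eq_append, List.reverse_append, List.prod_append,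
    List.reverse_singleton, List.prod_singleton, prodLeft]

theorem prodRight_succ' {m : ℕ} (f : Fin (m + 1) → R) :
    prodRight f = f 0 * prodRight fun i : Fin m => f i.succ := by
  simp [prodRight, List.ofFn_succ]

theorem prodLeft_succ' {m : ℕ} (f : Fin (m + 1) → R) :
    prodLeft f = prodLeft (fun i : Fin m => f i.succ) * f 0 := by
  simp [prodLeft, List.ofFn_succ]

@[simp]
theorem prodRight_zero (f : Fin 0 → R) : prodRight f = 1 := by simp [prodRight]

@[simp]
theorem prodLeft_zero (f : Fin 0 → R) : prodLeft f = 1 := by simp [prodLeft]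

theorem Commute.prodRight_right {m : ℕ} {f : Fin m → R} {y : R} (h : ∀ i, Commute y (f i)) :
    Commute y (prodRight f) := by
  induction m with
  | zero => simp
  | succ m ih => rw [prodRight_succ]; exact (ih fun i => h _).mul_right (h _)

theorem Commute.prodLeft_right {m : ℕ} {f : Fin m → R} {y : R} (h : ∀ i, Commute y (f i)) :
    Commute y (prodLeft f) := by
  induction m with
  | zero => simp
  | succ m ih => rw [prodLeft_succ]; exact (h _).mul_right (ih fun i => h _)

end OrderedProducts

/-! ### From tableaux to standard lists -/

namespace StandardTableau

/-- The nodes of a standard tableau in decreasing order of their entries. -/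
def toList : (m : ℕ) → StandardTableau m → List (ℕ × ℕ)
  | 0, _ => []
  | m + 1, T => T.node (Fin.last m) :: toList m T.init

@[simp]
theorem length_toList {m : ℕ} (T : StandardTableau m) : (toList m T).length = m := by
  induction m with
  | zero => rfl
  | succ m ih => simp [toList, ih]

theorem mem_toList {m : ℕ} (T : StandardTableau m) {α : ℕ × ℕ} :
    α ∈ toList m T ↔ α ∈ T.shape := by
  rw [T.mem_shape_iff]
  induction m with
  | zero => simp [toList]
  | succ m ih =>
    rw [toList, List.mem_cons, ih]
    constructor
    · rintro (rfl | ⟨a, ha⟩)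
      exacts [⟨_, rfl⟩, ⟨a.castSucc, ha⟩]
    · rintro ⟨a, rfl⟩
      induction a using Fin.lastCases with
      | last => exact Or.inl rfl
      | cast a => exact Or.inr ⟨a, rfl⟩

theorem isStandardList_toList {m : ℕ} (T : StandardTableau m) : IsStandardList (toList m T) := by
  induction m with
  | zero => trivial
  | succ m ih =>
    have key : ∀ β, β ≤ T.node (Fin.last m) → β ≠ T.node (Fin.last m) → β ∈ toList m T.init := by
      intro β hβ hne
      have h : β ∈ toList (m + 1) T := T.mem_toList.2
        (T.shape.isLowerSet hβ ((T.mem_shape_iff _).2 ⟨_, rfl⟩))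
      exact (List.mem_cons.1 h).resolve_left hne
    refine ⟨⟨fun h => ?_, fun r e => key _ ?_ ?_, fun c e => key _ ?_ ?_⟩, ih _⟩
    · obtain ⟨a, ha⟩ := (T.init.mem_shape_iff _).1 (T.init.mem_toList.1 h)
      exact a.castSucc_lt_last.ne (T.node_injective ha)
    · exact Prod.le_def.2 ⟨by dsimp only; omega, le_rfl⟩
    · exact fun h => by have := congrArg Prod.fst h; dsimp only at this; omega
    · exact Prod.le_def.2 ⟨le_rfl, by dsimp only; omega⟩
    · exact fun h => by have := congrArg Prod.snd h; dsimp only at this; omega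

theorem addableTo_toList_iff {m : ℕ} (T : StandardTableau m) {α : ℕ × ℕ} :
    AddableTo α (toList m T) ↔ T.shape.IsAddable α := by
  constructor
  · intro h
    refine ⟨fun h' => h.1 (T.mem_toList.2 h'), fun a b hb ha => ?_⟩
    rcases ha with rfl | ha
    · by_cases e : b = a
      · exact Or.inl e
      · exact Or.inr (T.mem_toList.1 (h.mem_of_lt T.isStandardList_toList hb e))
    · exact Or.inr (T.shape.isLowerSet hb ha)
  · intro h
    have key : ∀ β, β ≤ α → β ≠ α → β ∈ toList m T := fun β hβ hne =>
      T.mem_toList.2 ((h.2 hβ (Set.mem_insert _ _)).resolve_left hne)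
    refine ⟨fun h' => h.1 (T.mem_toList.1 h'), fun r e => key _ ?_ ?_, fun c e => key _ ?_ ?_⟩
    · exact Prod.le_def.2 ⟨by dsimp only; omega, le_rfl⟩
    · exact fun h => by have := congrArg Prod.fst h; dsimp only at this; omega
    · exact Prod.le_def.2 ⟨le_rfl, by dsimp only; omega⟩
    · exact fun h => by have := congrArg Prod.snd h; dsimp only at this; omega

theorem mem_addable {m : ℕ} (T : StandardTableau m) {α : ℕ × ℕ} :
    α ∈ T.shape.addable ↔ AddableTo α (toList m T) := by
  rw [addableTo_toList_iff, YoungDiagram.addable, Set.Finite.mem_toFinset, Set.mem_ofPred_eq]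

theorem node_last_mem_addable {m : ℕ} (T : StandardTableau (m + 1)) :
    T.node (Fin.last m) ∈ T.init.shape.addable :=
  T.init.mem_addable.2 T.isStandardList_toList.1

/-- This makes the denominators in `idem` nonzero and the roots of the annihilating polynomial
simple. -/
theorem injOn_quantumContent_addable {q : ℂ} (hq0 : q ≠ 0) (hq : ∀ k : ℕ, 0 < k → q ^ k ≠ 1)
    {m : ℕ} (T : StandardTableau m) :
    Set.InjOn (quantumContent q) (T.shape.addable : Set (ℕ × ℕ)) := by
  intro α hα β hβ h
  rw [quantumContent_eq_iff hq0 hq] at h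
  exact ((T.mem_addable.1 hα).eq_of_diagonal (T.mem_addable.1 hβ) T.isStandardList_toList
    (by omega) (by omega)).symm

theorem prod_addableContents {q : ℂ} (hq0 : q ≠ 0) (hq : ∀ k : ℕ, 0 < k → q ^ k ≠ 1)
    {m : ℕ} (T : StandardTableau m) :
    ∏ μ ∈ addableContents q (toList m T), (X - C μ) =
      ∏ α ∈ T.shape.addable, (X - C (quantumContent q α)) := by
  have : addableContents q (toList m T) = T.shape.addable.image (quantumContent q) := by
    ext μ
    simp [mem_addableContents, mem_addable]
  rw [this, Finset.prod_image (T.injOn_quantumContent_addable hq0 hq)]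

end StandardTableau

/-! ### The elements A_j^T are idempotents onto weight spaces -/

section Idempotent

variable {R : Type*} [Ring R] [Algebra ℂ R] {q : ℂ} {N : ℕ} {s : ℕ → R} {j m : ℕ}

theorem idem_intertwine {s' : ℕ → R} {j' : ℕ} {V : R} (T : StandardTableau m)
    (h : ∀ i, i + 1 < m → V * s' (j' + i) = s (j + i) * V) :
    V * idem q s' j' m T = idem q s j m T * V := by
  induction m with
  | zero => simp [idem]
  | succ m ih =>
    rw [idem, idem, ← mul_assoc, ih T.init fun i hi => h i (by omega), mul_assoc,
      mul_aeval_of_mul_eq (jucysMurphy_intertwine fun i hi => h i (by omega)), mul_assoc]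

theorem Commute.idem_right {y : R} (T : StandardTableau m)
    (h : ∀ i, i + 1 < m → Commute y (s (j + i))) : Commute y (idem q s j m T) :=
  idem_intertwine T h

/-- On such a vector every factor (J - c_α)/(c_m - c_α) evaluates to 1. -/
theorem idem_mul_of_isWeightVector (hq0 : q ≠ 0) (hq : ∀ k : ℕ, 0 < k → q ^ k ≠ 1)
    (T : StandardTableau m) {v : R}
    (hv : IsWeightVector q s j (T.toList m) v) : idem q s j m T * v = v := by
  induction m with
  | zero => simp [idem]
  | succ m ih =>
    have h1 := hv.1
    rw [T.init.length_toList] at h1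
    rw [idem, mul_assoc, aeval_mul_of_eigenvector h1, mul_smul_comm, ih _ hv.2,
      eval_prod, Finset.prod_eq_one, one_smul]
    intro α hα
    obtain ⟨hne, hα⟩ := Finset.mem_erase.1 hα
    rw [eval_mul, eval_C, eval_sub, eval_X, eval_C, inv_mul_cancel₀]
    rw [sub_ne_zero]
    exact fun e => hne (T.init.injOn_quantumContent_addable hq0 hq T.node_last_mem_addable hα
      e).symm

namespace IsHeckeFamily

variable (H : IsHeckeFamily q N s)
include H

theorem idem_commute_jucysMurphy (hj : 1 ≤ j) (hN : j + m ≤ N) (T : StandardTableau m) :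
    Commute (idem q s j m T) (jucysMurphy s j m) :=
  (Commute.idem_right T fun _ hi => (H.commute_jucysMurphy_of_lt hj hN hi).symm).symm

theorem idem_succ (hj : 1 ≤ j) (hN : j + m ≤ N) (T : StandardTableau (m + 1)) :
    ∃ p : ℂ[X], idem q s j (m + 1) T =
      aeval (jucysMurphy s j m) p * idem q s j m T.init :=
  ⟨_, (H.idem_commute_jucysMurphy hj hN T.init).aeval_right _⟩

/-- The product defining the last step of `idem` omits one root, the content of the last node.
Multiplying by J minus this content completes the annihilating polynomial of the smaller tableau. -/
theorem isWeightVector_idem (hq0 : q ≠ 0) (hq : ∀ k : ℕ, 0 < k → q ^ k ≠ 1) (hj : 1 ≤ j)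
    (hN : j + m ≤ N + 1) (T : StandardTableau m) :
    IsWeightVector q s j (T.toList m) (idem q s j m T) := by
  induction m with
  | zero => trivial
  | succ m ih =>
    have hlen : (T.init.toList m).length = m := T.init.length_toList
    have hA := ih (by omega) T.init
    rw [idem, ((H.idem_commute_jucysMurphy hj (by omega) T.init).aeval_right _).eq]
    refine ⟨?_, H.isWeightVector_jucysMurphy_mul hj hlen.le (by omega) hA _⟩
    have h0 := H.annihilatesWeight hq0 hq hj (by omega) T.init.isStandardList_toList _ hA
    rw [hlen, T.init.prod_addableContents hq0 hq,
      ← Finset.mul_prod_erase _ _ T.node_last_mem_addable] at h0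
    rw [hlen, ← sub_eq_zero, Finset.prod_mul_distrib]
    set P := ∏ α ∈ T.init.shape.addable.erase (T.node (Fin.last m)), (X - C (quantumContent q α))
    set K := ∏ α ∈ T.init.shape.addable.erase (T.node (Fin.last m)),
      C (quantumContent q (T.node (Fin.last m)) - quantumContent q α)⁻¹
    set c := quantumContent q (T.node (Fin.last m))
    calc _ = aeval (jucysMurphy s j m) (K * ((X - C c) * P)) * idem q s j m T.init := by
          rw [show K * ((X - C c) * P) = (X - C c) * (K * P) by ring, map_mul _ (X - C c)]
          simp only [map_sub, aeval_X, aeval_C, sub_mul, mul_assoc, Algebra.smul_def]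
      _ = 0 := by rw [map_mul _ K, mul_assoc, h0, mul_zero]

theorem idem_mul_idem (hq0 : q ≠ 0) (hq : ∀ k : ℕ, 0 < k → q ^ k ≠ 1)
    (hj : 1 ≤ j) (hN : j + m ≤ N + 1) (T : StandardTableau m) :
    idem q s j m T * idem q s j m T = idem q s j m T :=
  idem_mul_of_isWeightVector hq0 hq T (H.isWeightVector_idem hq0 hq hj hN T)

theorem idem_mul_jucysMurphy (hq0 : q ≠ 0) (hq : ∀ k : ℕ, 0 < k → q ^ k ≠ 1)
    (hj : 1 ≤ j) (hN : j + m < N + 1) (T : StandardTableau (m + 1)) :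
    idem q s j (m + 1) T * jucysMurphy s j m =
      T.contents q (Fin.last m) • idem q s j (m + 1) T := by
  have h1 := (H.isWeightVector_idem hq0 hq hj (by omega) T).1
  rw [T.init.length_toList] at h1
  have hc : Commute (jucysMurphy s j m) (idem q s j (m + 1) T) :=
    (H.idem_commute_jucysMurphy hj (by omega) T.init).symm.mul_right
      ((Commute.refl _).aeval_right _)
  rw [← hc.eq]
  exact h1

end IsHeckeFamily

end Idempotent

/-! ### Fusion: absorption of shifted projectors by rows and columns -/

section Fusion

variable {R : Type*} [Ring R] [Algebra ℂ R] {q : ℂ} {N : ℕ} {s : ℕ → R} {j m : ℕ}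

/-- The product `σ_{j+m-1}⁻¹ ⋯ σ_j⁻¹`. -/
def sigmaInvProd (q : ℂ) (s : ℕ → R) (j : ℕ) : ℕ → R
  | 0 => 1
  | m + 1 => (s (j + m) - (q - q⁻¹) • (1 : R)) * sigmaInvProd q s j m

theorem Commute.sigmaInvProd_right {y : R} (h : ∀ i < m, Commute y (s (j + i))) :
    Commute y (sigmaInvProd q s j m) := by
  induction m with
  | zero => exact Commute.one_right y
  | succ m ih =>
    exact ((h m (by omega)).sub_right ((Commute.one_right y).smul_right _)).mul_right
      (ih fun i hi => h i (by omega))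

/-- A product of Baxterized elements, with the poles cleared, depends polynomially on the
spectral parameter. -/
theorem exists_polynomial_eval_fwdX (q : ℂ) (s : ℕ → R) (j : ℕ) (c : Fin m → ℂ)
    (f : Module.Dual ℂ R) (a b : R) :
    ∃ p : ℂ[X], ∀ x : ℂ, (∀ i, x * c i ≠ 1) →
      p.eval x = (∏ i, (1 - x * c i)) * f (a * fwdX q s j (fun i => x * c i) * b) := by
  induction m generalizing b with
  | zero => exact ⟨C (f (a * b)), fun x _ => by simp [fwdX]⟩
  | succ m ih =>
    obtain ⟨p, hp⟩ := ih (fun i => c i.castSucc) (s (j + m) * b)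
    obtain ⟨r, hr⟩ := ih (fun i => c i.castSucc) b
    refine ⟨(1 - X * C (c (Fin.last m))) * p + C ((q - q⁻¹) * c (Fin.last m)) * X * r,
      fun x hx => ?_⟩
    have hne : 1 - x * c (Fin.last m) ≠ 0 := sub_ne_zero.2 (hx _).symm
    simp only [eval_add, eval_mul, eval_sub, eval_one, eval_X, eval_C, hp x fun i => hx _,
      hr x fun i => hx _]
    rw [Fin.prod_univ_castSucc, fwdX, fwdX, prodRight_succ, bax_eq]
    simp only [Fin.val_castSucc, Fin.val_last, mul_add, add_mul, mul_assoc, mul_smul_comm,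
      smul_mul_assoc, one_mul, map_add, map_smul, smul_eq_mul]
    field_simp

namespace IsHeckeFamily

variable (H : IsHeckeFamily q N s)
include H

theorem sigma_mul_sigmaInv {i : ℕ} (hi : 1 ≤ i) (hN : i < N) :
    s i * (s i - (q - q⁻¹) • (1 : R)) = 1 := by
  rw [mul_sub, H.quadratic i hi hN, mul_smul_comm, mul_one]; abel

theorem sigmaInv_mul_sigma {i : ℕ} (hi : 1 ≤ i) (hN : i < N) :
    (s i - (q - q⁻¹) • (1 : R)) * s i = 1 := by
  rw [sub_mul, H.quadratic i hi hN, smul_mul_assoc, one_mul]; abel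

theorem eq_zero_of_sigmaInvProd_mul (hj : 1 ≤ j) (hN : j + m ≤ N) {v : R}
    (h : sigmaInvProd q s j m * v = 0) : v = 0 := by
  induction m with
  | zero => simpa [sigmaInvProd] using h
  | succ m ih =>
    refine ih (by omega) ?_
    have := congrArg (s (j + m) * ·) h
    simpa only [sigmaInvProd, ← mul_assoc, H.sigma_mul_sigmaInv (show 1 ≤ j + m by omega)
      (show j + m < N by omega), one_mul, mul_zero] using this

/-- The braid relation in the form b⁻¹ a⁻¹ b = a b⁻¹ a⁻¹; the remaining factors commute. It lowers
the base index of A^T by one. -/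
theorem sigmaInvProd_mul_sigma (hj : 1 ≤ j) (hN : j + m ≤ N) {i : ℕ} (hi : i + 1 < m) :
    sigmaInvProd q s j m * s (j + 1 + i) = s (j + i) * sigmaInvProd q s j m := by
  induction m with
  | zero => omega
  | succ m ih =>
    rw [sigmaInvProd]
    rcases Nat.lt_or_ge (i + 1) m with h | h
    · have hc : Commute (s (j + i)) (s (j + m) - (q - q⁻¹) • (1 : R)) :=
        (H.comm_of_ne (by omega)).sub_right ((Commute.one_right _).smul_right _)
      rw [mul_assoc, ih (by omega) h, ← mul_assoc, ← hc.eq, mul_assoc]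
    · obtain rfl : m = i + 1 := by omega
      have hc : Commute (s (j + 1 + i)) (sigmaInvProd q s j i) :=
        .sigmaInvProd_right fun k hk => H.comm_of_ne (by omega)
      have hb := H.braid (j + i) (by omega) (by omega)
      rw [sigmaInvProd]
      rw [show j + 1 + i = j + i + 1 by omega] at hc ⊢
      rw [show j + (i + 1) = j + i + 1 by omega]
      have ha := H.sigma_mul_sigmaInv (i := j + i) (by omega) (by omega)
      have ha' := H.sigmaInv_mul_sigma (i := j + i) (by omega) (by omega)
      have hB := H.sigma_mul_sigmaInv (i := j + i + 1) (by omega) (by omega)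
      have hB' := H.sigmaInv_mul_sigma (i := j + i + 1) (by omega) (by omega)
      set a := s (j + i)
      set b := s (j + i + 1)
      set a' := a - (q - q⁻¹) • (1 : R)
      set b' := b - (q - q⁻¹) • (1 : R)
      have key : b' * a' * b = a * b' * a' := by
        calc b' * a' * b = b' * a' * (b * a * b) * b' * a' := by
              simp only [mul_assoc]
              rw [← mul_assoc b b', hB, one_mul, ha, mul_one]
          _ = a * b' * a' := by
              rw [← hb]
              simp only [mul_assoc]
              rw [← mul_assoc a' a, ha', one_mul, ← mul_assoc b' b, hB', one_mul]
      calc b' * (a' * sigmaInvProd q s j i) * b = b' * a' * b * sigmaInvProd q s j i := by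
            simp only [mul_assoc, hc.eq]
        _ = _ := by rw [key]; simp only [mul_assoc]

/-- Each step of the induction trades X(y/c)(J - y) for (J' - y) σ⁻¹, where J, J' are consecutive
Jucys–Murphy elements. This is legitimate behind A^T because A^T turns J into the content c of the
last node. -/
theorem idem_mul_prodLeft_bax_eq (hq0 : q ≠ 0) (hq : ∀ k : ℕ, 0 < k → q ^ k ≠ 1) (hj : 1 ≤ j)
    (hN : j + m ≤ N) (T : StandardTableau m) {y : ℂ} (hy : y ≠ 1)
    (hT : ∀ i, y / T.contents q i ≠ 1) :
    idem q s j m T * prodLeft (fun i : Fin m => bax q s (j + (i : ℕ)) (y / T.contents q i)) =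
      (1 - y)⁻¹ • (idem q s j m T * (jucysMurphy s j m - y • (1 : R)) * sigmaInvProd q s j m) := by
  induction m with
  | zero =>
    have : 1 - y ≠ 0 := sub_ne_zero.2 hy.symm
    simp only [idem, prodLeft_zero, mul_one, jucysMurphy, one_mul, sigmaInvProd]
    rw [show (1 : R) - y • (1 : R) = (1 - y) • (1 : R) by module, smul_smul, inv_mul_cancel₀ this, one_smul]
  | succ m ih =>
    have ih := ih (by omega) T.init fun i => hT i.castSucc
    have hJ := H.idem_mul_jucysMurphy hq0 hq hj (by omega) T
    have hlast := hT (Fin.last m)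
    have hc0 : T.contents q (Fin.last m) ≠ 0 := quantumContent_ne_zero hq0 _
    obtain ⟨p, hp⟩ := H.idem_succ hj (show j + m ≤ N by omega) T
    have hcom : Commute (bax q s (j + m) (y / T.contents q (Fin.last m)))
        (idem q s j m T.init) :=
      (Commute.bax_right (Commute.idem_right T.init fun i hi =>
        H.comm_of_ne (by omega)).symm _).symm
    have hgJ := H.sigma_mul_jucysMurphy hj (show j + m < N by omega)
    have key : idem q s j (m + 1) T * (bax q s (j + m) (y / T.contents q (Fin.last m)) *
        (jucysMurphy s j m - y • (1 : R))) =
        idem q s j (m + 1) T * ((jucysMurphy s j (m + 1) - y • (1 : R)) *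
          (s (j + m) - (q - q⁻¹) • (1 : R))) := by
      rw [bax_eq]
      set c := T.contents q (Fin.last m)
      set A := idem q s j (m + 1) T
      have hc : c - y ≠ 0 := fun e => hlast (by rw [← sub_eq_zero.1 e, div_self hc0])
      have hc' : 1 - y / c ≠ 0 := sub_ne_zero.2 hlast.symm
      have ecoef : (q - q⁻¹) * (y / c) / (1 - y / c) = (q - q⁻¹) * y / (c - y) := by
        field_simp
      rw [ecoef]
      simp only [mul_add, add_mul, mul_sub, sub_mul, mul_smul_comm, smul_mul_assoc, mul_one,
        one_mul, hgJ, hJ]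
      match_scalars <;> field_simp
    have e : prodLeft (fun i : Fin (m + 1) => bax q s (j + (i : ℕ)) (y / T.contents q i)) =
        bax q s (j + m) (y / T.contents q (Fin.last m)) *
          prodLeft (fun i : Fin m => bax q s (j + (i : ℕ)) (y / T.init.contents q i)) :=
      prodLeft_succ _
    -- A^T is a polynomial in J times A^{T.init}, and the latter passes the new factor to meet the
    -- shorter column.
    calc _ = aeval (jucysMurphy s j m) p * (bax q s (j + m) (y / T.contents q (Fin.last m)) *
          (idem q s j m T.init *
            prodLeft (fun i : Fin m => bax q s (j + (i : ℕ)) (y / T.init.contents q i)))) := by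
          rw [e, hp, ← mul_assoc (bax _ _ _ _) (idem _ _ _ _ _), hcom.eq]
          simp only [mul_assoc]
      _ = (1 - y)⁻¹ • (aeval (jucysMurphy s j m) p *
          (bax q s (j + m) (y / T.contents q (Fin.last m)) * idem q s j m T.init) *
            (jucysMurphy s j m - y • (1 : R)) * sigmaInvProd q s j m) := by
          rw [ih]
          simp only [mul_smul_comm, mul_assoc]
      _ = (1 - y)⁻¹ • (idem q s j (m + 1) T * (bax q s (j + m) (y / T.contents q (Fin.last m)) *
            (jucysMurphy s j m - y • (1 : R))) * sigmaInvProd q s j m) := by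
          rw [hcom.eq, hp]
          simp only [mul_assoc]
      _ = _ := by
          rw [key, sigmaInvProd]
          simp only [mul_assoc]

theorem sigmaInvProd_mul_idem (hj : 1 ≤ j) (hN : j + m ≤ N) (T : StandardTableau m) :
    sigmaInvProd q s j m * idem q s (j + 1) m T = idem q s j m T * sigmaInvProd q s j m :=
  idem_intertwine T fun _ hi => H.sigmaInvProd_mul_sigma hj hN hi

/-- Left absorption of the shifted projector by a column of Baxterized elements. -/
theorem idem_mul_prodLeft_bax (hq0 : q ≠ 0) (hq : ∀ k : ℕ, 0 < k → q ^ k ≠ 1) (hj : 1 ≤ j)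
    (hN : j + m ≤ N) (T : StandardTableau m) {y : ℂ} (hT : ∀ i, y / T.contents q i ≠ 1) :
    idem q s j m T * prodLeft (fun i : Fin m => bax q s (j + (i : ℕ)) (y / T.contents q i)) *
      idem q s (j + 1) m T =
    idem q s j m T * prodLeft (fun i : Fin m => bax q s (j + (i : ℕ)) (y / T.contents q i)) := by
  by_cases hy : y = 1
  · cases m with
    | zero => simp [idem]
    | succ m =>
      -- The entry 1 sits in the corner, whose content is 1, so y = 1 would be a pole.
      refine absurd ?_ (hT 0)
      have h0 : T.node 0 = (0, 0) := by
        have : (0, 0) ∈ T.shape := T.shape.isLowerSet (show (0, 0) ≤ T.node 0 from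
          Prod.le_def.2 ⟨Nat.zero_le _, Nat.zero_le _⟩) ((T.mem_shape_iff _).2 ⟨_, rfl⟩)
        obtain ⟨a, ha⟩ := (T.mem_shape_iff _).1 this
        have : a ≤ 0 := T.le_of_node_le (ha ▸ Prod.le_def.2 ⟨Nat.zero_le _, Nat.zero_le _⟩)
        rw [← Fin.le_zero_iff.1 this, ha]
      simp [hy, StandardTableau.contents, h0, quantumContent]
  · rw [H.idem_mul_prodLeft_bax_eq hq0 hq hj hN T hy hT, smul_mul_assoc]
    congr 1
    have hc : Commute (idem q s j m T) (jucysMurphy s j m - y • (1 : R)) :=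
      (H.idem_commute_jucysMurphy hj hN T).sub_right ((Commute.one_right _).smul_right _)
    rw [mul_assoc _ _ (idem _ _ _ _ _), H.sigmaInvProd_mul_idem hj hN, ← mul_assoc, hc.eq,
      mul_assoc (_ - _) (idem q s j m T), H.idem_mul_idem hq0 hq hj (by omega)]

theorem prodLeft_bax_mul_fwdX (hj : 1 ≤ j) (hN : j + m ≤ N) {c : Fin m → ℂ}
    {x : ℂ} (hx : x ≠ 0) (hc0 : ∀ i, c i ≠ 0) (hc : ∀ i, x * c i ≠ 1) :
    ∃ κ : ℂ, prodLeft (fun i : Fin m => bax q s (j + (i : ℕ)) (x⁻¹ / c i)) *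
      fwdX q s j (fun i => x * c i) = κ • (1 : R) := by
  induction m with
  | zero => exact ⟨1, by simp [fwdX]⟩
  | succ m ih =>
    obtain ⟨κ, h⟩ := ih (c := fun i => c i.castSucc) (by omega) (fun i => hc0 _) fun i => hc _
    obtain ⟨κ', h'⟩ : ∃ κ' : ℂ, bax q s (j + m) (x * c (Fin.last m))⁻¹ *
        bax q s (j + m) (x * c (Fin.last m)) = κ' • (1 : R) :=
      ⟨_, H.bax_mul_bax_inv (by omega) (by omega) (mul_ne_zero hx (hc0 _)) (hc _)⟩
    refine ⟨κ * κ', ?_⟩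
    rw [fwdX, prodLeft_succ, prodRight_succ, mul_assoc, ← mul_assoc (prodLeft _)]
    rw [fwdX] at h
    simp only [Fin.val_castSucc, Fin.val_last]
    rw [h, smul_mul_assoc, one_mul, mul_smul_comm, div_eq_mul_inv x⁻¹, ← mul_inv, h', smul_smul]

/-- Right absorption of the shifted projector by a row of Baxterized elements. -/
theorem idem_mul_fwdX (hq0 : q ≠ 0) (hq : ∀ k : ℕ, 0 < k → q ^ k ≠ 1) (hj : 1 ≤ j)
    (hN : j + m ≤ N) (T : StandardTableau m) {x : ℂ} (hT : ∀ i, x * T.contents q i ≠ 1) :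
    idem q s (j + 1) m T * fwdX q s j (fun i => x * T.contents q i) * idem q s j m T =
    idem q s (j + 1) m T * fwdX q s j (fun i => x * T.contents q i) := by
  set A := idem q s j m T with hA
  set A' := idem q s (j + 1) m T
  set c := T.contents q
  have hc0 : ∀ i, c i ≠ 0 := fun i => quantumContent_ne_zero hq0 _
  have hidem : A * A = A := H.idem_mul_idem hq0 hq hj (by omega) T
  set S := addableContents q (T.toList m)
  -- The column with parameter 1/x inverts the row up to a scalar, and A(1 - A) = 0. By the fusion
  -- formula J - 1/x therefore kills A σ⁻¹⋯σ⁻¹ · row · (1 - A). This is a weight vector, so it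
  -- vanishes when 1/x is not an addable content.
  have generic : ∀ x : ℂ, x ≠ 0 → x ≠ 1 → (∀ i, x * c i ≠ 1) → x⁻¹ ∉ S →
      A' * fwdX q s j (fun i => x * c i) * (1 - A) = 0 := by
    intro x hx0 hx1 hxc hxS
    have hy : x⁻¹ ≠ 1 := by simpa using hx1
    have hyc : ∀ i, x⁻¹ / c i ≠ 1 := fun i => by
      rw [div_eq_mul_inv, ← mul_inv, ne_eq, inv_eq_one]; exact hxc i
    obtain ⟨κ, hκ⟩ := H.prodLeft_bax_mul_fwdX hj hN hx0 hc0 hxc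
    have h1 := H.idem_mul_prodLeft_bax_eq hq0 hq hj hN T hy hyc
    have h2 := congrArg (· * fwdX q s j (fun i => x * c i) * (1 - A)) h1
    have hcomm : Commute A (jucysMurphy s j m - x⁻¹ • (1 : R)) :=
      (H.idem_commute_jucysMurphy hj hN T).sub_right ((Commute.one_right _).smul_right _)
    have hz : A * (1 - A) = 0 := by rw [mul_sub, hidem, mul_one, sub_self]
    refine H.eq_zero_of_sigmaInvProd_mul hj hN ?_
    have hV : sigmaInvProd q s j m * A' = A * sigmaInvProd q s j m :=
      H.sigmaInvProd_mul_idem hj hN T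
    rw [← mul_assoc, ← mul_assoc, hV]
    have hw : IsWeightVector q s j (T.toList m)
        (A * sigmaInvProd q s j m * fwdX q s j (fun i => x * c i) * (1 - A)) :=
      (((H.isWeightVector_idem hq0 hq hj (by omega) T).mul_right _).mul_right _).mul_right _
    refine (H.annihilatesWeight hq0 hq hj (by simpa using hN) T.isStandardList_toList).eq_zero hw
      (μ := x⁻¹) ?_ hxS
    rw [T.length_toList, ← sub_eq_zero]
    have h3 : (1 - x⁻¹)⁻¹ • ((jucysMurphy s j m - x⁻¹ • (1 : R)) *
        (A * sigmaInvProd q s j m * fwdX q s j (fun i => x * c i) * (1 - A))) = 0 := by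
      rw [← hA, hcomm.eq] at h2
      simp only [smul_mul_assoc, mul_assoc] at h2 ⊢
      rw [← h2]
      have := congrArg (A * · * (1 - A)) hκ
      simp only [mul_assoc] at this
      rw [this, smul_mul_assoc, one_mul, mul_smul_comm, hz, smul_zero]
    have h4 := (smul_eq_zero.1 h3).resolve_left (inv_ne_zero (sub_ne_zero.2 hy.symm))
    rwa [sub_mul, smul_mul_assoc, one_mul] at h4
  rw [eq_comm, ← sub_eq_zero]
  have e : ∀ y : R, A' * y - A' * y * A = A' * y * (1 - A) := fun y => by rw [mul_sub, mul_one]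
  -- For the excluded x: with the poles cleared, every linear functional of the defect is a
  -- polynomial in x that vanishes off a finite set. Linear functionals separate the points of R.
  rw [e, ← Module.forall_dual_apply_eq_zero_iff ℂ]
  intro f
  obtain ⟨p, hp⟩ := exists_polynomial_eval_fwdX q s j c f A' (1 - A)
  have hp0 : p = 0 := by
    refine p.eq_zero_of_infinite_isRoot (Set.Infinite.mono (s := (({0, 1} ∪
      Finset.univ.image (fun i => (c i)⁻¹) ∪ S.image (·⁻¹) : Finset ℂ) : Set ℂ)ᶜ) ?_
      (Finset.finite_toSet _).infinite_compl)
    intro x hx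
    simp only [Set.mem_compl_iff, Finset.mem_coe, Finset.mem_union, Finset.mem_insert,
      Finset.mem_singleton, Finset.mem_image, Finset.mem_univ, true_and, not_or, not_exists,
      not_and] at hx
    obtain ⟨⟨⟨h0, h1⟩, h2⟩, h3⟩ := hx
    have hxc : ∀ i, x * c i ≠ 1 := fun i h => h2 i (eq_comm.1 (eq_inv_of_mul_eq_one_left h))
    rw [Set.mem_ofPred_eq, IsRoot, hp x hxc, generic x h0 h1 hxc fun h => h3 _ h (inv_inv x)]
    simp
  have := hp x hT
  rw [hp0, eval_zero, eq_comm, mul_eq_zero] at this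
  exact this.resolve_left (Finset.prod_ne_zero_iff.2 fun i _ => sub_ne_zero.2 (hT i).symm)

end IsHeckeFamily
end Fusion
end

noncomputable section

/-! ### Recursions for rows of Baxterized elements -/

section Recursions

@[simp]
theorem prodLeft_one {R : Type*} [Ring R] {m : ℕ} : prodLeft (fun _ : Fin m => (1 : R)) = 1 := by
  simp [prodLeft]

variable {R : Type*} [Ring R] [Algebra ℂ R] {q : ℂ} {s : ℕ → R} {m : ℕ}

theorem fwdX_succ (j : ℕ) (u : Fin (m + 1) → ℂ) :
    fwdX q s j u = fwdX q s j (fun k => u k.castSucc) * bax q s (j + m) (u (Fin.last m)) :=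
  prodRight_succ _

theorem fwdX_succ' (j : ℕ) (u : Fin (m + 1) → ℂ) :
    fwdX q s j u = bax q s j (u 0) * fwdX q s (j + 1) (fun k => u k.succ) := by
  rw [fwdX, prodRight_succ', fwdX]
  simp only [Fin.val_zero, add_zero, Fin.val_succ, add_assoc, add_comm 1]

theorem bwdX_succ (j : ℕ) (u : Fin (m + 1) → ℂ) :
    bwdX q s j u = bwdX q s (j + 1) (fun k => u k.castSucc) * bax q s j (u (Fin.last m)) := by
  rw [bwdX, prodRight_succ, bwdX]
  simp only [Fin.rev_castSucc, Fin.val_succ, Fin.rev_last, Fin.val_zero, add_zero, add_assoc,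
    add_comm 1]

theorem bwdX_succ' (j : ℕ) (u : Fin (m + 1) → ℂ) :
    bwdX q s j u = bax q s (j + m) (u 0) * bwdX q s j (fun k => u k.succ) := by
  rw [bwdX, prodRight_succ', bwdX]
  simp only [Fin.rev_zero, Fin.val_last, Fin.rev_succ, Fin.val_castSucc]

@[simp]
theorem fwdX_zero (j : ℕ) (u : Fin 0 → ℂ) : fwdX q s j u = 1 := prodRight_zero _

@[simp]
theorem bwdX_zero (j : ℕ) (u : Fin 0 → ℂ) : bwdX q s j u = 1 := prodRight_zero _

theorem Commute.fwdX_right {y : R} {j : ℕ} (h : ∀ i < m, Commute y (s (j + i))) (u : Fin m → ℂ) :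
    Commute y (fwdX q s j u) :=
  .prodRight_right fun i => (h i i.2).bax_right _

theorem Commute.bwdX_right {y : R} {j : ℕ} (h : ∀ i < m, Commute y (s (j + i))) (u : Fin m → ℂ) :
    Commute y (bwdX q s j u) :=
  .prodRight_right fun i => (h i.rev i.rev.2).bax_right _

end Recursions

/-! ### The boundary element at position j -/

section BoundaryElement

variable {R : Type*} [Ring R] [Algebra ℂ R] {q : ℂ} {N : ℕ} {s : ℕ → R} {t : ℂ → R}

theorem baxTau_one (x : ℂ) : baxTau q s t 1 x = t x := by
  simp [baxTau]

theorem baxTau_succ {j : ℕ} (hj : 1 ≤ j) (x : ℂ) :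
    baxTau q s t (j + 1) x = bax q s j x * baxTau q s t j x * bax q s j x := by
  obtain ⟨k, rfl⟩ : ∃ k, j = k + 1 := ⟨j - 1, by omega⟩
  simp only [baxTau]
  rw [bwdX_succ', fwdX_succ, add_comm 1 k]
  simp only [mul_assoc]; rfl

namespace IsHeckeFamily

variable (H : IsHeckeFamily q N s)
include H

theorem baxTau_commute {x : ℂ} (hx : ∀ i, 2 ≤ i → Commute (t x) (s i)) {j i : ℕ} (hj : 1 ≤ j)
    (hi : j < i) : Commute (baxTau q s t j x) (s i) := by
  refine Commute.symm (((Commute.bwdX_right (fun k hk => ?_) _).mul_right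
    (hx i (by omega)).symm).mul_right (Commute.fwdX_right (fun k hk => ?_) _))
  · exact H.comm_of_ne (by omega)
  · exact H.comm_of_ne (by omega)

/-- The reflection equation for the boundary element moved to the position `j`. -/
theorem baxTau_reflection {x y : ℂ} (hx : ∀ i, 2 ≤ i → Commute (t x) (s i))
    (hy : ∀ i, 2 ≤ i → Commute (t y) (s i)) (hy0 : y ≠ 0) (h1 : x / y ≠ 1) (h2 : x * y ≠ 1)
    (h : bax q s 1 (x / y) * t x * bax q s 1 (x * y) * t y =
      t y * bax q s 1 (x * y) * t x * bax q s 1 (x / y)) {j : ℕ} (hj : 1 ≤ j) (hN : j < N)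
    (hp : 2 ≤ j → x ≠ 1 ∧ y ≠ 1) :
    bax q s j (x / y) * baxTau q s t j x * bax q s j (x * y) * baxTau q s t j y =
      baxTau q s t j y * bax q s j (x * y) * baxTau q s t j x * bax q s j (x / y) := by
  induction j, hj using Nat.le_induction with
  | base => simpa only [baxTau_one] using h
  | succ j hj ih =>
    obtain ⟨hx1, hy1⟩ := hp (by omega)
    have ih := ih (by omega) fun _ => ⟨hx1, hy1⟩
    have e1 := H.yangBaxter hj hN (rfl : x * y = x * y) hx1 hy1 h2
    have e2 := H.yangBaxter hj hN (show x = y * (x / y) by field_simp) hy1 h1 hx1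
    have e3 := H.yangBaxter hj hN (show x = x / y * y by field_simp) h1 hy1 hx1
    have e4 := H.yangBaxter hj hN (show x * y = y * x by ring) hy1 hx1 h2
    have c : ∀ a b : ℂ, (∀ i, 2 ≤ i → Commute (t b) (s i)) →
        Commute (bax q s (j + 1) a) (baxTau q s t j b) := fun a b hb =>
      ((H.baxTau_commute hb hj (Nat.lt_succ_self j)).bax_right a).symm
    rw [baxTau_succ hj, baxTau_succ hj]
    set K := baxTau q s t j x
    set L := baxTau q s t j y
    -- The induction step uses four Yang–Baxter moves around the equation at position j. The factors
    -- X_{j+1} travel through the reflections, which do not involve σ_{j+1}.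
    have c1 := fun a => (c a x hx).eq
    have c2 := fun a => (c a y hy).eq
    set A := bax q s j
    set B := bax q s (j + 1)
    calc B (x / y) * (A x * K * A x) * B (x * y) * (A y * L * A y)
        = B (x / y) * A x * K * (A x * B (x * y) * A y) * L * A y := by simp only [mul_assoc]
      _ = B (x / y) * A x * (K * B y) * A (x * y) * (B x * L) * A y := by
          rw [e1]; simp only [mul_assoc]
      _ = (B (x / y) * A x * B y) * K * A (x * y) * L * B x * A y := by
          rw [← c1, c2]; simp only [mul_assoc]; rfl
      _ = A y * B x * (A (x / y) * K * A (x * y) * L) * B x * A y := by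
          rw [← e2]; simp only [mul_assoc]
      _ = A y * (B x * L) * A (x * y) * K * (A (x / y) * B x * A y) := by
          rw [ih]; simp only [mul_assoc]
      _ = A y * L * B x * A (x * y) * (K * B y) * A x * B (x / y) := by
          rw [e3, c2]; simp only [mul_assoc]; rfl
      _ = A y * L * (B x * A (x * y) * B y) * K * A x * B (x / y) := by
          rw [← c1]; simp only [mul_assoc]; rfl
      _ = _ := by
          rw [← e4]; simp only [mul_assoc]

end IsHeckeFamily
end BoundaryElement

/-! ### Yang–Baxter moves for one line crossing a block -/

section Lines

variable {R : Type*} [Ring R] [Algebra ℂ R] {q : ℂ} {N : ℕ} {s : ℕ → R}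

namespace IsHeckeFamily

variable (H : IsHeckeFamily q N s)
include H

/-- A crossing of two lines is pulled through a block of m further lines, by one Yang–Baxter move
for each. The next two lemmas are the same move for other orders of the factors. -/
theorem bax_mul_bwdX_mul_bwdX {j m : ℕ} (hj : 1 ≤ j) (hN : j + m < N) {a : ℂ} {p r : Fin m → ℂ}
    (hp : ∀ k, p k = r k * a) (ha : a ≠ 1) (hp1 : ∀ k, p k ≠ 1) (hr : ∀ k, r k ≠ 1) :
    bax q s (j + m) a * bwdX q s j p * bwdX q s (j + 1) r =
      bwdX q s j r * bwdX q s (j + 1) p * bax q s j a := by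
  induction m generalizing j with
  | zero => simp
  | succ m ih =>
    have ih := ih (j := j + 1) (p := fun k => p k.castSucc) (r := fun k => r k.castSucc)
      (by omega) (by omega) (fun k => hp _) (fun k => hp1 _) fun k => hr _
    have e := H.yangBaxter hj (by omega) (hp (Fin.last m)) (hr _) ha (hp1 _)
    have c : ∀ (x : ℂ) (f : Fin m → ℂ),
        Commute (bax q s j x) (bwdX q s (j + 1 + 1) f) := fun x f =>
      Commute.bwdX_right (fun i _ => (Commute.bax_right (H.comm_of_ne (by omega)) x).symm) f
    rw [show j + 1 + m = j + (m + 1) by omega] at ih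
    rw [bwdX_succ j, bwdX_succ (j + 1), bwdX_succ j, bwdX_succ (j + 1)]
    set X := bax q s j
    set Y := bax q s (j + 1)
    set P := bwdX q s (j + 1) fun k => p k.castSucc
    set P' := bwdX q s (j + 1 + 1) fun k => p k.castSucc
    set Q := bwdX q s (j + 1) fun k => r k.castSucc
    set Q' := bwdX q s (j + 1 + 1) fun k => r k.castSucc
    calc bax q s (j + (m + 1)) a * (P * X (p (Fin.last m))) * (Q' * Y (r (Fin.last m)))
        = bax q s (j + (m + 1)) a * P * (X (p (Fin.last m)) * Q') * Y (r (Fin.last m)) := by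
          simp only [mul_assoc]
      _ = (bax q s (j + (m + 1)) a * P * Q') * X (p (Fin.last m)) * Y (r (Fin.last m)) := by
          rw [(c _ _).eq]; simp only [mul_assoc]; rfl
      _ = Q * P' * (Y a * X (p (Fin.last m)) * Y (r (Fin.last m))) := by
          rw [ih]; simp only [mul_assoc]
      _ = Q * (P' * X (r (Fin.last m))) * Y (p (Fin.last m)) * X a := by
          rw [← e]; simp only [mul_assoc]
      _ = _ := by rw [← (c _ _).eq]; simp only [mul_assoc]; rfl

theorem fwdX_mul_fwdX_mul_bax {j m : ℕ} (hj : 1 ≤ j) (hN : j + m < N) {a : ℂ} {p r : Fin m → ℂ}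
    (hp : ∀ k, p k = a * r k) (ha : a ≠ 1) (hp1 : ∀ k, p k ≠ 1) (hr : ∀ k, r k ≠ 1) :
    fwdX q s (j + 1) r * fwdX q s j p * bax q s (j + m) a =
      bax q s j a * fwdX q s (j + 1) p * fwdX q s j r := by
  induction m with
  | zero => simp
  | succ m ih =>
    have ih := ih (p := fun k => p k.castSucc) (r := fun k => r k.castSucc)
      (by omega) (fun k => hp _) (fun k => hp1 _) fun k => hr _
    have e := H.yangBaxter (i := j + m) (by omega) (by omega) (hp (Fin.last m)) ha (hr _) (hp1 _)
    have c : ∀ (x : ℂ) (f : Fin m → ℂ),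
        Commute (bax q s (j + m + 1) x) (fwdX q s j f) := fun x f =>
      Commute.fwdX_right (fun i _ => (Commute.bax_right (H.comm_of_ne (by omega)) x).symm) f
    rw [fwdX_succ j, fwdX_succ (j + 1), fwdX_succ j, fwdX_succ (j + 1)]
    rw [show j + 1 + m = j + m + 1 by omega, show j + (m + 1) = j + m + 1 by omega]
    set X := bax q s (j + m)
    set Y := bax q s (j + m + 1)
    set P := fwdX q s j fun k => p k.castSucc
    set P' := fwdX q s (j + 1) fun k => p k.castSucc
    set Q := fwdX q s j fun k => r k.castSucc
    set Q' := fwdX q s (j + 1) fun k => r k.castSucc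
    calc Q' * Y (r (Fin.last m)) * (P * X (p (Fin.last m))) * Y a
        = Q' * (Y (r (Fin.last m)) * P) * X (p (Fin.last m)) * Y a := by
          simp only [mul_assoc]
      _ = Q' * P * (Y (r (Fin.last m)) * X (p (Fin.last m)) * Y a) := by
          rw [(c _ _).eq]; simp only [mul_assoc]; rfl
      _ = (Q' * P * X a) * Y (p (Fin.last m)) * X (r (Fin.last m)) := by
          rw [← e]; simp only [mul_assoc]
      _ = bax q s j a * P' * (Q * Y (p (Fin.last m))) * X (r (Fin.last m)) := by
          rw [ih]; simp only [mul_assoc]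
      _ = _ := by rw [← (c _ _).eq]; simp only [mul_assoc]; rfl

theorem fwdX_mul_bax_mul_bwdX {j n : ℕ} (hj : 1 ≤ j) (hN : j + n < N) {a : ℂ} {p r : Fin n → ℂ}
    (hp : ∀ k, a = p k * r k) (ha : a ≠ 1) (hp1 : ∀ k, p k ≠ 1) (hr : ∀ k, r k ≠ 1) :
    fwdX q s j (fun k => p k.rev) * bax q s (j + n) a * bwdX q s j r =
      bwdX q s (j + 1) r * bax q s j a * fwdX q s (j + 1) (fun k => p k.rev) := by
  induction n generalizing j with
  | zero => simp
  | succ n ih =>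
    have ih := ih (j := j + 1) (p := fun k => p k.castSucc) (r := fun k => r k.castSucc)
      (by omega) (by omega) (fun k => hp _) (fun k => hp1 _) fun k => hr _
    have e := H.yangBaxter hj (by omega) (hp (Fin.last n)) (hp1 _) (hr _) ha
    have c : ∀ (x : ℂ) (f : Fin n → ℂ),
        Commute (bax q s j x) (bwdX q s (j + 1 + 1) f) := fun x f =>
      Commute.bwdX_right (fun i _ => (Commute.bax_right (H.comm_of_ne (by omega)) x).symm) f
    have c' : ∀ (x : ℂ) (f : Fin n → ℂ),
        Commute (bax q s j x) (fwdX q s (j + 1 + 1) f) := fun x f =>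
      Commute.fwdX_right (fun i _ => (Commute.bax_right (H.comm_of_ne (by omega)) x).symm) f
    rw [show j + 1 + n = j + (n + 1) by omega] at ih
    rw [bwdX_succ j, bwdX_succ (j + 1), fwdX_succ' j, fwdX_succ' (j + 1)]
    simp only [Fin.rev_zero, Fin.rev_succ]
    set X := bax q s j
    set Y := bax q s (j + 1)
    set P := fwdX q s (j + 1) fun k => p k.rev.castSucc
    set P' := fwdX q s (j + 1 + 1) fun k => p k.rev.castSucc
    set Q := bwdX q s (j + 1) fun k => r k.castSucc
    set Q' := bwdX q s (j + 1 + 1) fun k => r k.castSucc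
    calc X (p (Fin.last n)) * P * bax q s (j + (n + 1)) a * (Q * X (r (Fin.last n)))
        = X (p (Fin.last n)) * (P * bax q s (j + (n + 1)) a * Q) * X (r (Fin.last n)) := by
          simp only [mul_assoc]
      _ = (X (p (Fin.last n)) * Q') * Y a * (P' * X (r (Fin.last n))) := by
          rw [ih]; simp only [mul_assoc]
      _ = Q' * (X (p (Fin.last n)) * Y a * X (r (Fin.last n))) * P' := by
          rw [(c _ _).eq, ← (c' _ _).eq]; simp only [mul_assoc]; rfl
      _ = _ := by rw [e]; simp only [mul_assoc]

end IsHeckeFamily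
end Lines

/-! ### Crossings and reflections of two blocks with arbitrary parameters -/

section Blocks

variable {R : Type*} [Ring R] [Algebra ℂ R] {q : ℂ} {N : ℕ} {s : ℕ → R} {m n : ℕ}

/-- Crossing of two blocks of lines with spectral parameters `u_i v_k`. -/
def crossPP (q : ℂ) (s : ℕ → R) (j : ℕ) (u : Fin m → ℂ) (v : Fin n → ℂ) : R :=
  prodLeft fun i : Fin m => fwdX q s (j + (i : ℕ)) fun k : Fin n => u i.rev * v k

/-- Crossing of two blocks of lines with spectral parameters `u_i / v_k`. -/
def crossPM (q : ℂ) (s : ℕ → R) (j : ℕ) (u : Fin m → ℂ) (v : Fin n → ℂ) : R :=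
  prodLeft fun i : Fin m => fwdX q s (j + (i : ℕ)) fun k : Fin n => u i.rev / v k.rev

/-- Crossing of two blocks of lines with spectral parameters `v_k / u_i`. -/
def crossMP (q : ℂ) (s : ℕ → R) (j : ℕ) (u : Fin m → ℂ) (v : Fin n → ℂ) : R :=
  prodLeft fun i : Fin m => fwdX q s (j + (i : ℕ)) fun k : Fin n => v k / u i

/-- Reflection of a block of lines, `K x` being the reflection of a line. -/
def blockReflection (q : ℂ) (s : ℕ → R) (K : ℂ → R) (j : ℕ) (u : Fin m → ℂ) : R :=
  prodRight fun i : Fin m =>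
    bwdX q s j (fun k : Fin (i : ℕ) => u i * u (k.castLE i.isLt.le)) * K (u i)

theorem crossPP_succ (j : ℕ) (u : Fin (m + 1) → ℂ) (v : Fin n → ℂ) :
    crossPP q s j u v = crossPP q s (j + 1) (fun i => u i.castSucc) v *
      fwdX q s j (fun k => u (Fin.last m) * v k) := by
  rw [crossPP, prodLeft_succ', crossPP]
  simp only [Fin.val_zero, add_zero, Fin.val_succ, Fin.rev_zero, Fin.rev_succ, add_assoc,
    add_comm 1]

theorem crossPM_succ (j : ℕ) (u : Fin (m + 1) → ℂ) (v : Fin n → ℂ) :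
    crossPM q s j u v = crossPM q s (j + 1) (fun i => u i.castSucc) v *
      fwdX q s j (fun k => u (Fin.last m) / v k.rev) := by
  rw [crossPM, prodLeft_succ', crossPM]
  simp only [Fin.val_zero, add_zero, Fin.val_succ, Fin.rev_zero, Fin.rev_succ, add_assoc,
    add_comm 1]

theorem crossMP_succ (j : ℕ) (u : Fin (m + 1) → ℂ) (v : Fin n → ℂ) :
    crossMP q s j u v = fwdX q s (j + m) (fun k => v k / u (Fin.last m)) *
      crossMP q s j (fun i => u i.castSucc) v :=
  prodLeft_succ _

theorem blockReflection_succ (K : ℂ → R) (j : ℕ) (u : Fin (m + 1) → ℂ) :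
    blockReflection q s K j u = blockReflection q s K j (fun i => u i.castSucc) *
      (bwdX q s j (fun k => u (Fin.last m) * u k.castSucc) * K (u (Fin.last m))) :=
  prodRight_succ _

theorem Commute.crossPP_right {y : R} {j : ℕ} (h : ∀ i, i + 1 < m + n → Commute y (s (j + i)))
    (u : Fin m → ℂ) (v : Fin n → ℂ) : Commute y (crossPP q s j u v) :=
  .prodLeft_right fun i => .fwdX_right (fun k hk => by
    rw [add_assoc]; exact h _ (by omega)) _

theorem Commute.crossPM_right {y : R} {j : ℕ} (h : ∀ i, i + 1 < m + n → Commute y (s (j + i)))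
    (u : Fin m → ℂ) (v : Fin n → ℂ) : Commute y (crossPM q s j u v) :=
  .prodLeft_right fun i => .fwdX_right (fun k hk => by
    rw [add_assoc]; exact h _ (by omega)) _

theorem Commute.crossMP_right {y : R} {j : ℕ} (h : ∀ i, i + 1 < m + n → Commute y (s (j + i)))
    (u : Fin m → ℂ) (v : Fin n → ℂ) : Commute y (crossMP q s j u v) :=
  .prodLeft_right fun i => .fwdX_right (fun k hk => by
    rw [add_assoc]; exact h _ (by omega)) _

theorem Commute.blockReflection_right {y : R} {K : ℂ → R} {j : ℕ} {u : Fin m → ℂ}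
    (h : ∀ i, i + 1 < m → Commute y (s (j + i))) (hK : ∀ i, Commute y (K (u i))) :
    Commute y (blockReflection q s K j u) :=
  .prodRight_right fun i => (Commute.bwdX_right (fun k hk => h _ (by omega)) _).mul_right (hK i)

namespace IsHeckeFamily

variable (H : IsHeckeFamily q N s)
include H

theorem bwdX_commute_fwdX {i j : ℕ} (h : i + m < j) (u : Fin n → ℂ) (v : Fin m → ℂ) :
    Commute (bwdX q s j u) (fwdX q s i v) :=
  .fwdX_right (fun _ _ => .symm (.bwdX_right (fun _ _ => H.comm_of_ne (by omega)) _)) _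

/-- The definition splits off lines of the first block. This and the next two lemmas split off the
last line of the second block, for the induction on n in `blockReflection_reflection`. -/
theorem crossPP_succ_right (j : ℕ) (u : Fin m → ℂ) (v : Fin (n + 1) → ℂ) :
    crossPP q s j u v = crossPP q s j u (fun k => v k.castSucc) *
      bwdX q s (j + n) (fun i => u i * v (Fin.last n)) := by
  induction m generalizing j with
  | zero => simp [crossPP]
  | succ m ih =>
    rw [crossPP_succ, crossPP_succ, ih, fwdX_succ, bwdX_succ, show j + 1 + n = j + n + 1 by omega]
    have c := (H.bwdX_commute_fwdX (i := j) (j := j + n + 1) (by omega)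
      (fun i : Fin m => u i.castSucc * v (Fin.last n))
      (fun k : Fin n => u (Fin.last m) * v k.castSucc)).eq
    rw [← mul_assoc, mul_assoc _ (bwdX _ _ _ _), c]
    simp only [mul_assoc]

theorem crossPM_succ_right (j : ℕ) (u : Fin m → ℂ) (v : Fin (n + 1) → ℂ) :
    crossPM q s j u v = bwdX q s j (fun i => u i / v (Fin.last n)) *
      crossPM q s (j + 1) u (fun k => v k.castSucc) := by
  induction m generalizing j with
  | zero => simp [crossPM]
  | succ m ih =>
    rw [crossPM_succ, crossPM_succ, ih, fwdX_succ', bwdX_succ]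
    simp only [Fin.rev_zero, Fin.rev_succ]
    have c : Commute (bax q s j (u (Fin.last m) / v (Fin.last n)))
        (crossPM q s (j + 1 + 1) (fun i => u i.castSucc) fun k => v k.castSucc) :=
      .crossPM_right (fun i _ => .symm (.bax_right (H.comm_of_ne (by omega)) _)) _ _
    rw [← mul_assoc, mul_assoc _ (crossPM _ _ _ _ _), ← c.eq]
    simp only [mul_assoc]

theorem crossMP_succ_right (j : ℕ) (u : Fin m → ℂ) (v : Fin (n + 1) → ℂ) :
    crossMP q s j u v = crossMP q s j u (fun k => v k.castSucc) *
      prodLeft (fun i : Fin m => bax q s (j + n + i) (v (Fin.last n) / u i)) := by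
  induction m with
  | zero => simp [crossMP]
  | succ m ih =>
    rw [crossMP_succ, crossMP_succ, ih, fwdX_succ, prodLeft_succ]
    have c : Commute (bax q s (j + m + n) (v (Fin.last n) / u (Fin.last m)))
        (crossMP q s j (fun i => u i.castSucc) fun k => v k.castSucc) :=
      .crossMP_right (fun i _ => .symm (.bax_right (H.comm_of_ne (by omega)) _)) _ _
    rw [mul_assoc, ← mul_assoc (bax _ _ _ _), c.eq]
    simp only [Fin.val_castSucc, Fin.val_last, mul_assoc, add_right_comm j n m]

/-- A third line w passes through the crossing of two blocks; the next lemma is the variant for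
quotient parameters. -/
theorem fwdX_mul_crossPP_mul_bwdX {j : ℕ} (hj : 1 ≤ j) (hN : j + m + n ≤ N) {u : Fin m → ℂ}
    {v : Fin n → ℂ} {w : ℂ} (hw : w ≠ 0) (h1 : ∀ i, u i / w ≠ 1) (h2 : ∀ k, w * v k ≠ 1)
    (h3 : ∀ i k, u i * v k ≠ 1) :
    fwdX q s (j + n) (fun i => u i / w) * crossPP q s j v u *
        bwdX q s (j + m) (fun k => w * v k) =
      bwdX q s j (fun k => w * v k) * crossPP q s (j + 1) v u *
        fwdX q s j (fun i => u i / w) := by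
  induction n generalizing j with
  | zero => simp [crossPP]
  | succ n ih =>
    have ih := ih (j := j + 1) (v := fun k => v k.castSucc) (by omega) (by omega)
      (fun k => h2 _) fun i k => h3 _ _
    rw [crossPP_succ j, crossPP_succ (j + 1), bwdX_succ (j + m), bwdX_succ j]
    rw [show j + 1 + m = j + m + 1 by omega, show j + 1 + n = j + (n + 1) by omega] at ih
    have e := H.fwdX_mul_fwdX_mul_bax hj (show j + m < N by omega) (a := w * v (Fin.last n))
      (p := fun i => v (Fin.last n) * u i) (r := fun i => u i / w)
      (fun k => by field_simp) (h2 _) (fun k => by rw [mul_comm]; exact h3 _ _) h1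
    have c1 := (H.bwdX_commute_fwdX (i := j) (j := j + m + 1) (by omega)
      (fun k : Fin n => w * v k.castSucc) (fun i : Fin m => v (Fin.last n) * u i)).eq
    have c2 : Commute (bax q s j (w * v (Fin.last n)))
        (crossPP q s (j + 1 + 1) (fun k => v k.castSucc) u) :=
      .crossPP_right (fun i _ => .symm (.bax_right (H.comm_of_ne (by omega)) _)) _ _
    set F := fwdX q s (j + (n + 1)) fun i => u i / w
    set F1 := fwdX q s (j + 1) fun i => u i / w
    set F0 := fwdX q s j fun i => u i / w
    set P1 := crossPP q s (j + 1) (fun k => v k.castSucc) u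
    set P2 := crossPP q s (j + 1 + 1) (fun k => v k.castSucc) u
    set f := fwdX q s j fun i => v (Fin.last n) * u i
    set f1 := fwdX q s (j + 1) fun i => v (Fin.last n) * u i
    set Gm := bwdX q s (j + m + 1) fun k => w * v k.castSucc
    set G := bwdX q s (j + 1) fun k => w * v k.castSucc
    calc F * (P1 * f) * (Gm * bax q s (j + m) (w * v (Fin.last n)))
        = F * P1 * (f * Gm) * bax q s (j + m) (w * v (Fin.last n)) := by simp only [mul_assoc]
      _ = (F * P1 * Gm) * f * bax q s (j + m) (w * v (Fin.last n)) := by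
          rw [← c1]; simp only [mul_assoc]
      _ = G * P2 * (F1 * f * bax q s (j + m) (w * v (Fin.last n))) := by
          rw [ih]; simp only [mul_assoc]
      _ = G * (P2 * bax q s j (w * v (Fin.last n))) * f1 * F0 := by
          rw [e]; simp only [mul_assoc]
      _ = _ := by rw [← c2.eq]; simp only [mul_assoc]

theorem crossPM_mul_bwdX_mul_bwdX {j : ℕ} (hj : 1 ≤ j) (hN : j + m + n ≤ N) {u : Fin m → ℂ}
    {v : Fin n → ℂ} {w : ℂ} (hv : ∀ k, v k ≠ 0) (h1 : ∀ i, u i * w ≠ 1) (h2 : ∀ k, w * v k ≠ 1)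
    (h3 : ∀ i k, u i / v k ≠ 1) :
    crossPM q s j u v * bwdX q s (j + n) (fun i => u i * w) * bwdX q s j (fun k => w * v k) =
      bwdX q s (j + m) (fun k => w * v k) * bwdX q s j (fun i => u i * w) *
        crossPM q s (j + 1) u v := by
  induction m generalizing j with
  | zero => simp [crossPM]
  | succ m ih =>
    have ih := ih (j := j + 1) (u := fun k => u k.castSucc) (by omega) (by omega)
      (fun k => h1 _) fun i k => h3 _ _
    rw [crossPM_succ j, crossPM_succ (j + 1), bwdX_succ (j + n), bwdX_succ j (fun i => u i * w)]
    rw [show j + 1 + m = j + (m + 1) by omega, show j + 1 + n = j + n + 1 by omega] at ih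
    have e := H.fwdX_mul_bax_mul_bwdX hj (show j + n < N by omega) (a := u (Fin.last m) * w)
      (p := fun k => u (Fin.last m) / v k) (r := fun k => w * v k)
      (fun k => by have := hv k; field_simp) (h1 _) (h3 _) h2
    have c1 := (H.bwdX_commute_fwdX (i := j) (j := j + n + 1) (by omega)
      (fun i : Fin m => u i.castSucc * w) (fun k : Fin n => u (Fin.last m) / v k.rev)).eq
    have c2 : Commute (bax q s j (u (Fin.last m) * w))
        (crossPM q s (j + 1 + 1) (fun i => u i.castSucc) v) :=
      .crossPM_right (fun i _ => .symm (.bax_right (H.comm_of_ne (by omega)) _)) _ _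
    set P1 := crossPM q s (j + 1) (fun i => u i.castSucc) v
    set P2 := crossPM q s (j + 1 + 1) (fun i => u i.castSucc) v
    set f := fwdX q s j fun k => u (Fin.last m) / v k.rev
    set f1 := fwdX q s (j + 1) fun k => u (Fin.last m) / v k.rev
    set Q := bwdX q s (j + n + 1) fun i => u i.castSucc * w
    set Q1 := bwdX q s (j + 1) fun i => u i.castSucc * w
    set G := bwdX q s j fun k => w * v k
    set G1 := bwdX q s (j + 1) fun k => w * v k
    set Gm := bwdX q s (j + (m + 1)) fun k => w * v k
    calc P1 * f * (Q * bax q s (j + n) (u (Fin.last m) * w)) * G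
        = P1 * (f * Q) * bax q s (j + n) (u (Fin.last m) * w) * G := by simp only [mul_assoc]
      _ = P1 * Q * (f * bax q s (j + n) (u (Fin.last m) * w) * G) := by
          rw [← c1]; simp only [mul_assoc]
      _ = (P1 * Q * G1) * bax q s j (u (Fin.last m) * w) * f1 := by
          rw [e]; simp only [mul_assoc]
      _ = Gm * Q1 * (P2 * bax q s j (u (Fin.last m) * w)) * f1 := by
          rw [ih]; simp only [mul_assoc]
      _ = _ := by rw [← c2.eq]; simp only [mul_assoc]

/-- A block against a single line w: the last line of the block is exchanged with w at the boundary
by `hRE`, the others by induction, and two moves of type `bax_mul_bwdX_mul_bwdX` bring the crossings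
into place. -/
theorem blockReflection_reflection_line {K : ℂ → R} {j : ℕ} (hj : 1 ≤ j) (hN : j + m ≤ N)
    {u : Fin m → ℂ} {w : ℂ} (hw : w ≠ 0) (h1 : ∀ i, u i / w ≠ 1) (h2 : ∀ i, u i * w ≠ 1)
    (h3 : ∀ i k, k < i → u i * u k ≠ 1) (hK : ∀ i, ∀ l, j < l → Commute (K (u i)) (s l))
    (hKw : ∀ l, j < l → Commute (K w) (s l))
    (hRE : ∀ i, bax q s j (u i / w) * K (u i) * bax q s j (u i * w) * K w =
      K w * bax q s j (u i * w) * K (u i) * bax q s j (u i / w)) :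
    fwdX q s j (fun i => u i / w) * blockReflection q s K j u * bwdX q s j (fun i => u i * w) *
        K w =
      K w * fwdX q s j (fun i => w * u i) * blockReflection q s K j u *
        bwdX q s j (fun i => u i / w) := by
  induction m with
  | zero => simp [blockReflection]
  | succ m ih =>
    have ih' := ih (u := fun i => u i.castSucc) (by omega) (fun i => h1 _) (fun i => h2 _)
      (fun i k h => h3 _ _ h) (fun i => hK _) fun i => hRE _
    have hre := hRE (Fin.last m)
    rw [fwdX_succ, fwdX_succ, blockReflection_succ, bwdX_succ, bwdX_succ j (fun i => u i / w)]
    have hyu : ∀ k : Fin m, u (Fin.last m) * u k.castSucc ≠ 1 := fun k =>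
      h3 _ _ k.castSucc_lt_last
    have e1 := H.bax_mul_bwdX_mul_bwdX hj (show j + m < N by omega) (a := u (Fin.last m) / w)
      (p := fun k => u (Fin.last m) * u k.castSucc) (r := fun k : Fin m => u k.castSucc * w)
      (fun k => by field_simp) (h1 _) hyu fun k => h2 _
    have e2 := H.bax_mul_bwdX_mul_bwdX hj (show j + m < N by omega) (a := u (Fin.last m) * w)
      (p := fun k => u (Fin.last m) * u k.castSucc) (r := fun k : Fin m => u k.castSucc / w)
      (fun k => by field_simp) (h2 _) hyu fun k => h1 _
    have c1 : ∀ x, Commute (bax q s (j + m) x)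
        (blockReflection q s K j fun i => u i.castSucc) := fun x =>
      .blockReflection_right (fun i hi => .symm (.bax_right (H.comm_of_ne (by omega)) _))
        fun i => .symm (.bax_right (hK _ _ (by have := i.2; omega)) _)
    have c2 : ∀ f : Fin m → ℂ, Commute (K (u (Fin.last m))) (bwdX q s (j + 1) f) := fun f =>
      .bwdX_right (fun i _ => hK _ _ (by omega)) _
    have c3 : ∀ f : Fin m → ℂ, Commute (K w) (bwdX q s (j + 1) f) := fun f =>
      .bwdX_right (fun i _ => hKw _ (by omega)) _
    set y := u (Fin.last m)
    set F := fwdX q s j fun i : Fin m => u i.castSucc / w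
    set F' := fwdX q s j fun i : Fin m => w * u i.castSucc
    set B := blockReflection q s K j fun i : Fin m => u i.castSucc
    set Y := bwdX q s j fun i : Fin m => y * u i.castSucc
    set Y1 := bwdX q s (j + 1) fun i : Fin m => y * u i.castSucc
    set P := bwdX q s j fun i : Fin m => u i.castSucc * w
    set P1 := bwdX q s (j + 1) fun i : Fin m => u i.castSucc * w
    set Q := bwdX q s j fun i : Fin m => u i.castSucc / w
    set Q1 := bwdX q s (j + 1) fun i : Fin m => u i.castSucc / w
    set Z := bax q s (j + m)
    set X := bax q s j
    calc F * Z (y / w) * (B * (Y * K y)) * (P1 * X (y * w)) * K w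
        = F * (Z (y / w) * B) * Y * (K y * P1) * X (y * w) * K w := by simp only [mul_assoc]
      _ = F * B * (Z (y / w) * Y * P1) * K y * X (y * w) * K w := by
          rw [(c1 _).eq, (c2 _).eq]; simp only [mul_assoc]; rfl
      _ = F * B * P * Y1 * (X (y / w) * K y * X (y * w) * K w) := by
          rw [e1]; simp only [mul_assoc]
      _ = F * B * P * (Y1 * K w) * X (y * w) * K y * X (y / w) := by
          rw [hre]; simp only [mul_assoc]
      _ = (F * B * P * K w) * Y1 * X (y * w) * K y * X (y / w) := by
          rw [← (c3 _).eq]; simp only [mul_assoc]; rfl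
      _ = K w * F' * B * (Q * Y1 * X (y * w)) * K y * X (y / w) := by
          rw [ih']; simp only [mul_assoc]
      _ = K w * F' * (B * Z (y * w)) * Y * (Q1 * K y) * X (y / w) := by
          rw [← e2]; simp only [mul_assoc]
      _ = _ := by
          rw [← (c1 _).eq, ← (c2 _).eq, mul_comm y w]; simp only [mul_assoc]; rfl

/-- The reflection equation for two blocks of lines. -/
theorem blockReflection_reflection {K : ℂ → R} {j : ℕ} (hj : 1 ≤ j) (hN : j + m + n ≤ N + 1)
    {u : Fin m → ℂ} {v : Fin n → ℂ} (hv : ∀ k, v k ≠ 0) (h1 : ∀ i k, u i / v k ≠ 1)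
    (h2 : ∀ i k, u i * v k ≠ 1) (h3 : ∀ i k, k < i → u i * u k ≠ 1)
    (h4 : ∀ i k, k < i → v i * v k ≠ 1) (hK : ∀ i, ∀ l, j < l → Commute (K (u i)) (s l))
    (hK' : ∀ k, ∀ l, j < l → Commute (K (v k)) (s l))
    (hRE : ∀ i k, bax q s j (u i / v k) * K (u i) * bax q s j (u i * v k) * K (v k) =
      K (v k) * bax q s j (u i * v k) * K (u i) * bax q s j (u i / v k)) :
    crossMP q s j v u * blockReflection q s K j u * crossPP q s j u v *
        blockReflection q s K j v =
      blockReflection q s K j v * crossPP q s j v u * blockReflection q s K j u *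
        crossPM q s j u v := by
  induction n with
  | zero =>
    simp [crossMP, crossPP, crossPM, blockReflection]
  | succ n ih =>
    have ih := ih (v := fun k => v k.castSucc) (by omega) (fun k => hv _) (fun i k => h1 _ _)
      (fun i k => h2 _ _) (fun i k h => h4 _ _ h) (fun k => hK' _) fun i k => hRE _ _
    have hl := H.blockReflection_reflection_line hj (show j + m ≤ N by omega) (hv (Fin.last n))
      (fun i => h1 i _) (fun i => h2 i _) h3 hK (hK' _) fun i => hRE i _
    have hvv : ∀ k : Fin n, v (Fin.last n) * v k.castSucc ≠ 1 := fun k =>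
      h4 _ _ k.castSucc_lt_last
    have e1 := H.crossPM_mul_bwdX_mul_bwdX hj (show j + m + n ≤ N by omega) (u := u)
      (v := fun k => v k.castSucc) (w := v (Fin.last n)) (fun k => hv _) (fun i => h2 _ _) hvv
      fun i k => h1 _ _
    have e2 := H.fwdX_mul_crossPP_mul_bwdX hj (show j + m + n ≤ N by omega) (u := u)
      (v := fun k => v k.castSucc) (w := v (Fin.last n)) (hv _) (fun i => h1 _ _) hvv
      fun i k => h2 _ _
    -- The last line w of the second block is split off everywhere. The shorter block is reflected
    -- first, then w is pulled through the crossings, and finally w reflects against the whole first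
    -- block.
    rw [crossMP_succ, H.crossPP_succ_right, blockReflection_succ, crossPP_succ,
      H.crossPM_succ_right]
    have c0 : ∀ (i : ℕ), Commute (s (j + n + i))
        (blockReflection q s K j fun k => v k.castSucc) := fun i =>
      .blockReflection_right (fun l hl => H.comm_of_ne (by omega))
        fun k => (hK' _ _ (by have := k.2; omega)).symm
    have c1 : Commute (bwdX q s (j + n) fun i => u i * v (Fin.last n))
        (blockReflection q s K j fun k => v k.castSucc) :=
      .symm (.bwdX_right (fun i _ => (c0 i).symm) _)
    have c2 : Commute (fwdX q s (j + n) fun i => u i / v (Fin.last n))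
        (blockReflection q s K j fun k => v k.castSucc) :=
      .symm (.fwdX_right (fun i _ => (c0 i).symm) _)
    have c3 : Commute (bwdX q s (j + m) fun k : Fin n => v (Fin.last n) * v k.castSucc)
        (blockReflection q s K j u) :=
      .blockReflection_right
        (fun l hl => .symm (.bwdX_right (fun i _ => H.comm_of_ne (by omega)) _))
        fun i => .symm (.bwdX_right (fun l _ => hK _ _ (by have := i.2; omega)) _)
    have c4 : Commute (K (v (Fin.last n))) (crossPM q s (j + 1) u fun k => v k.castSucc) :=
      .crossPM_right (fun i _ => hK' _ _ (by omega)) _ _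
    have c5 : Commute (K (v (Fin.last n))) (crossPP q s (j + 1) (fun k => v k.castSucc) u) :=
      .crossPP_right (fun i _ => hK' _ _ (by omega)) _ _
    set w := v (Fin.last n)
    set F := fwdX q s (j + n) fun i => u i / w
    set F0 := fwdX q s j fun i => u i / w
    set M := crossMP q s j (fun k => v k.castSucc) u
    set B := blockReflection q s K j u
    set B' := blockReflection q s K j fun k => v k.castSucc
    set P := crossPP q s j u fun k => v k.castSucc
    set Q := bwdX q s (j + n) fun i => u i * w
    set Q0 := bwdX q s j fun i => u i * w
    set G := bwdX q s j fun k : Fin n => w * v k.castSucc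
    set Gm := bwdX q s (j + m) fun k : Fin n => w * v k.castSucc
    set P' := crossPP q s j (fun k => v k.castSucc) u
    set P1 := crossPP q s (j + 1) (fun k => v k.castSucc) u
    set f := fwdX q s j fun i => w * u i
    set L := bwdX q s j fun i => u i / w
    set Pm := crossPM q s j u fun k => v k.castSucc
    set Pm1 := crossPM q s (j + 1) u fun k => v k.castSucc
    calc F * M * B * (P * Q) * (B' * (G * K w))
        = F * M * B * P * (Q * B') * G * K w := by simp only [mul_assoc]
      _ = F * (M * B * P * B') * Q * G * K w := by rw [c1.eq]; simp only [mul_assoc]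
      _ = (F * B') * P' * B * (Pm * Q * G) * K w := by rw [ih]; simp only [mul_assoc]
      _ = B' * F * P' * (B * Gm) * Q0 * (Pm1 * K w) := by
          rw [e1, c2.eq]; simp only [mul_assoc]
      _ = B' * (F * P' * Gm) * B * Q0 * K w * Pm1 := by
          rw [← c3.eq, ← c4.eq]; simp only [mul_assoc]
      _ = B' * G * P1 * (F0 * B * Q0 * K w) * Pm1 := by rw [e2]; simp only [mul_assoc]
      _ = B' * G * (P1 * K w) * f * B * L * Pm1 := by rw [hl]; simp only [mul_assoc]
      _ = _ := by rw [← c5.eq]; simp only [mul_assoc]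

end IsHeckeFamily
end Blocks
end

noncomputable section

/-! ### The rational boundary element solves the reflection equation -/

section RationalSolution

variable {R : Type*} [Ring R] [Algebra ℂ R]

/-- With p, r the resolvents of T at ξ/x and ξ/y, both boundary elements are affine in a resolvent.
The equation then follows from the resolvent identity for p r and from a formula for the commutator
of σpσ with r. -/
theorem resolvent_reflection {σ T p r : R} {l ξ x y : ℂ} (hσ : σ * σ = l • σ + 1)
    (hT : Commute T (σ * T * σ)) (hx : x ≠ 0) (hy : y ≠ 0) (hxy : x / y ≠ 1) (hxy' : x * y ≠ 1)
    (hp : p * (T - (ξ * x⁻¹) • (1 : R)) = 1) (hp' : (T - (ξ * x⁻¹) • (1 : R)) * p = 1)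
    (hr : r * (T - (ξ * y⁻¹) • (1 : R)) = 1) (hr' : (T - (ξ * y⁻¹) • (1 : R)) * r = 1) :
    (σ + (l * (x / y) / (1 - x / y)) • (1 : R)) * (1 + (ξ * (x⁻¹ - x)) • p) *
        (σ + (l * (x * y) / (1 - x * y)) • (1 : R)) * (1 + (ξ * (y⁻¹ - y)) • r) =
      (1 + (ξ * (y⁻¹ - y)) • r) * (σ + (l * (x * y) / (1 - x * y)) • (1 : R)) *
        (1 + (ξ * (x⁻¹ - x)) • p) * (σ + (l * (x / y) / (1 - x / y)) • (1 : R)) := by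
  have hTp : T * p = 1 + (ξ * x⁻¹) • p := by
    rw [sub_mul, smul_mul_assoc, one_mul, sub_eq_iff_eq_add] at hp'; exact hp'
  have hpT : p * T = 1 + (ξ * x⁻¹) • p := by
    rw [mul_sub, mul_smul_comm, mul_one, sub_eq_iff_eq_add] at hp; exact hp
  have hTr : T * r = 1 + (ξ * y⁻¹) • r := by
    rw [sub_mul, smul_mul_assoc, one_mul, sub_eq_iff_eq_add] at hr'; exact hr'
  have hrT : r * T = 1 + (ξ * y⁻¹) • r := by
    rw [mul_sub, mul_smul_comm, mul_one, sub_eq_iff_eq_add] at hr; exact hr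
  have hcpr : r * p = p * r := by
    have h1 : (T - (ξ * x⁻¹) • (1 : R)) * r = r * (T - (ξ * x⁻¹) • (1 : R)) := by
      rw [sub_mul, mul_sub, hTr, hrT, smul_mul_assoc, one_mul, mul_smul_comm, mul_one]
    calc r * p = p * (T - (ξ * x⁻¹) • (1 : R)) * r * p := by rw [hp, one_mul]
      _ = p * (r * (T - (ξ * x⁻¹) • (1 : R))) * p := by rw [mul_assoc p, h1]
      _ = p * r * ((T - (ξ * x⁻¹) • (1 : R)) * p) := by simp only [mul_assoc]
      _ = p * r := by rw [hp', mul_one]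
  have hpr : (ξ * (y⁻¹ - x⁻¹)) • (p * r) = r - p := by
    have h1 : p * (T * r) = p + (ξ * y⁻¹) • (p * r) := by
      rw [hTr, mul_add, mul_one, mul_smul_comm]
    have h2 : p * (T * r) = r + (ξ * x⁻¹) • (p * r) := by
      rw [← mul_assoc, hpT, add_mul, one_mul, smul_mul_assoc]
    linear_combination (norm := module) h2 - h1
  have hSp : σ * T * σ * p = p * (σ * T * σ) := by
    have h1 : (T - (ξ * x⁻¹) • (1 : R)) * (σ * T * σ) =
        σ * T * σ * (T - (ξ * x⁻¹) • (1 : R)) := by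
      rw [sub_mul, mul_sub, hT.eq, smul_mul_assoc, one_mul, mul_smul_comm, mul_one]
    calc σ * T * σ * p = p * ((T - (ξ * x⁻¹) • (1 : R)) * (σ * T * σ)) * p := by
          rw [← mul_assoc p, hp, one_mul]
      _ = p * (σ * T * σ) * ((T - (ξ * x⁻¹) • (1 : R)) * p) := by
          rw [h1]; simp only [mul_assoc]
      _ = _ := by rw [hp', mul_one]
  have hσ' : ∀ a, σ * (σ * a) = l • (σ * a) + a := fun a => by
    rw [← mul_assoc, hσ, add_mul, smul_mul_assoc, one_mul]
  have hTσ : T * σ = σ * (σ * T * σ) - l • (σ * T * σ) := by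
    simp only [mul_assoc, hσ']
    abel
  have hσT : σ * T = σ * T * σ * σ - l • (σ * T * σ) := by
    simp only [mul_assoc, hσ, mul_add, mul_smul_comm, mul_one]
    abel
  -- σTσ commutes with T, hence with p. Writing Tσ = σ⁻¹(σTσ) and σT = (σTσ)σ⁻¹ lets it pass through
  -- p.
  have hZ : T * (σ * p * σ) - σ * p * σ * T = l • (T * σ * p - p * σ * T) := by
    have e1 : T * (σ * p * σ) =
        σ * p * (σ * T * σ * σ) - l • (p * (σ * T * σ * σ)) := by
      calc T * (σ * p * σ) = T * σ * p * σ := by simp only [mul_assoc]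
        _ = (σ * (σ * T * σ * p) - l • (σ * T * σ * p)) * σ := by
            rw [hTσ, sub_mul, smul_mul_assoc, mul_assoc σ]
        _ = _ := by rw [hSp, sub_mul, smul_mul_assoc]; simp only [mul_assoc]
    have e2 : T * σ * p = σ * p * (σ * T * σ) - l • (p * (σ * T * σ)) := by
      rw [hTσ, sub_mul, smul_mul_assoc, mul_assoc σ, hSp, ← mul_assoc]
    have e3 : σ * p * σ * T = σ * p * (σ * T * σ * σ) - l • (σ * p * (σ * T * σ)) := by
      conv_lhs => rw [mul_assoc (σ * p), hσT, mul_sub, mul_smul_comm]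
    have e4 : p * σ * T = p * (σ * T * σ * σ) - l • (p * (σ * T * σ)) := by
      conv_lhs => rw [mul_assoc p, hσT, mul_sub, mul_smul_comm]
    rw [e1, e2, e3, e4]
    module
  -- Multiplying the previous identity by r on both sides turns the commutator with T into the
  -- commutator with r.
  have E1 : σ * p * σ * r - r * (σ * p * σ) = l • (σ * (p * r) - p * r * σ) +
      (l * (ξ * y⁻¹)) • (r * σ * (p * r) - p * r * σ * r) := by
    have h := congrArg (r * · * r) hZ
    have e1 : r * (T * (σ * p * σ) - σ * p * σ * T) * r =
        σ * p * σ * r - r * (σ * p * σ) := by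
      rw [mul_sub, sub_mul, ← mul_assoc r T, hrT, mul_assoc r _ r, mul_assoc _ T r, hTr]
      simp only [add_mul, mul_add, one_mul, mul_one, smul_mul_assoc, mul_smul_comm, mul_assoc]
      abel
    have e2 : r * (T * σ * p - p * σ * T) * r = σ * (p * r) - p * r * σ +
        (ξ * y⁻¹) • (r * σ * (p * r) - p * r * σ * r) := by
      have : r * (T * σ * p - p * σ * T) * r = r * T * (σ * p * r) - r * p * σ * (T * r) := by
        simp only [mul_sub, sub_mul, mul_assoc]
      rw [this, hrT, hTr, hcpr]
      simp only [add_mul, mul_add, one_mul, mul_one, smul_mul_assoc, mul_smul_comm, mul_assoc]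
      module
    rw [e1, mul_smul_comm, smul_mul_assoc, e2] at h
    rw [h]
    module
  have E2 : (ξ * (y⁻¹ - x⁻¹)) • (r * σ * (p * r) - p * r * σ * r) = p * σ * r - r * σ * p := by
    rw [smul_sub, ← mul_smul_comm, hpr, ← smul_mul_assoc, ← smul_mul_assoc, hpr]
    simp only [mul_sub, sub_mul]
    abel
  have E3 : (ξ * (y⁻¹ - x⁻¹)) • (σ * (p * r)) = σ * r - σ * p := by
    rw [← mul_smul_comm, hpr, mul_sub]
  have E4 : (ξ * (y⁻¹ - x⁻¹)) • (p * r * σ) = r * σ - p * σ := by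
    rw [← smul_mul_assoc, hpr, sub_mul]
  have hδ : x - y ≠ 0 := fun e => hxy (by rw [sub_eq_zero.1 e, div_self hy])
  have h1xy : 1 - x * y ≠ 0 := sub_ne_zero.2 hxy'.symm
  have h1yx : 1 - y * x ≠ 0 := by rwa [mul_comm]
  have ha : l * (x / y) / (1 - x / y) = -(l * x) / (x - y) := by
    have h2 : y - x ≠ 0 := fun e => hδ (by rw [← neg_sub, e, neg_zero])
    have : 1 - x / y ≠ 0 := sub_ne_zero.2 hxy.symm
    field_simp
    ring
  rw [ha]
  simp only [mul_add, add_mul, mul_sub, smul_mul_assoc, mul_smul_comm, mul_one, one_mul,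
    mul_assoc, hσ, hcpr] at E1 E2 E3 E4 ⊢
  linear_combination (norm := skip) (ξ * (x⁻¹ - x) * (ξ * (y⁻¹ - y))) • E1 +
    (ξ * (x⁻¹ - x) * (ξ * (y⁻¹ - y)) * l * x / (x - y)) • E2 +
    (ξ * (x⁻¹ - x) * (y⁻¹ - y) * (l + l * (x * y) / (1 - x * y)) * (x * y) / (x - y)) • (E3 - E4)
  match_scalars <;> field_simp <;> ring


omit [Algebra ℂ R] in
theorem Commute.ringInverse_right {a b : R} (h : Commute a b) (hb : IsUnit b) :
    Commute a (Ring.inverse b) := by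
  obtain ⟨b, rfl⟩ := hb
  rw [Ring.inverse_unit]
  exact h.units_inv_right

theorem rationalTau_eq {ξ x : ℂ} {T : R} (h : IsUnit (T - algebraMap ℂ R (ξ * x⁻¹))) :
    rationalTau ξ T x =
      1 + (ξ * (x⁻¹ - x)) • Ring.inverse (T - algebraMap ℂ R (ξ * x⁻¹)) := by
  have e : T - algebraMap ℂ R (ξ * x) =
      (T - algebraMap ℂ R (ξ * x⁻¹)) + algebraMap ℂ R (ξ * (x⁻¹ - x)) := by
    rw [mul_sub, map_sub]; abel
  rw [rationalTau, e, add_mul, Ring.mul_inverse_cancel _ h, ← Algebra.smul_def]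

theorem Commute.rationalTau_right {a T : R} (h : Commute a T) {ξ x : ℂ}
    (hu : IsUnit (T - algebraMap ℂ R (ξ * x⁻¹))) : Commute a (rationalTau ξ T x) :=
  (h.sub_right (Algebra.commutes _ _).symm).mul_right
    ((h.sub_right (Algebra.commutes _ _).symm).ringInverse_right hu)

theorem isReflectionSolution_rationalTau {q : ℂ} (hq0 : q ≠ 0) {N : ℕ}
    (ρ : AffineHecke q N →ₐ[ℂ] R) (ξ : ℂ) :
    IsReflectionSolution q N (fun i => ρ (AffineHecke.sigma q N i))
      {y | y ≠ 0 ∧ IsUnit (ρ (AffineHecke.tau q N 1) - algebraMap ℂ R (ξ * y⁻¹))}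
      (rationalTau ξ (ρ (AffineHecke.tau q N 1))) where
  isLocal x hx i h2 _ :=
    ((AffineHecke.tau_one_commute_sigma ρ h2).symm.rationalTau_right hx.2).symm
  reflection x hx y hy _ h1 h2 := by
    rw [Set.mem_ofPred_eq] at hx hy
    by_cases hN : 1 < N
    · have hs := (AffineHecke.isHeckeFamily hq0 ρ).quadratic 1 le_rfl hN
      rw [rationalTau_eq hx.2, rationalTau_eq hy.2, bax_eq, bax_eq]
      have e := fun c : ℂ => Algebra.algebraMap_eq_smul_one (R := ℂ) (A := R) c
      refine resolvent_reflection hs (AffineHecke.tau_sigma_tau_sigma ρ) hx.1 hy.1 h1 h2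
        ?_ ?_ ?_ ?_
      · rw [← e, Ring.inverse_mul_cancel _ hx.2]
      · rw [← e, Ring.mul_inverse_cancel _ hx.2]
      · rw [← e, Ring.inverse_mul_cancel _ hy.2]
      · rw [← e, Ring.mul_inverse_cancel _ hy.2]
    -- For N ≤ 1 the out-of-range `sigma q N 1` is 0 and X_1 is a scalar, so it suffices that the
    -- two boundary values commute.
    · have hc : Commute (rationalTau ξ (ρ (AffineHecke.tau q N 1)) x)
          (rationalTau ξ (ρ (AffineHecke.tau q N 1)) y) :=
        ((Commute.refl _).rationalTau_right hx.2).symm.rationalTau_right hy.2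
      simp only [bax_eq, AffineHecke.sigma, hN, and_false, dif_neg, not_false_eq_true, map_zero,
        zero_add, smul_mul_assoc, mul_smul_comm, one_mul, mul_one, hc.eq, smul_smul]
      congr 1
      ring

end RationalSolution

/-! ### Absorption of projectors by whole crossings, and the projected equation -/

section Projected

variable {R : Type*} [Ring R] [Algebra ℂ R] {q : ℂ} {N : ℕ} {s : ℕ → R} {j m n : ℕ}

namespace IsHeckeFamily

variable (H : IsHeckeFamily q N s)
include H

/-- Each of the m rows lowers the base index of the absorbed projector by one. The next lemma goes
the opposite way, column by column. -/
theorem idem_mul_prodLeft_fwdX (hq0 : q ≠ 0) (hq : ∀ k : ℕ, 0 < k → q ^ k ≠ 1) (hj : 1 ≤ j)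
    (hN : j + m + n ≤ N + 1) (T : StandardTableau n) {f : Fin m → ℂ}
    (hf : ∀ i k, f i * T.contents q k ≠ 1) :
    idem q s (j + m) n T *
        prodLeft (fun i : Fin m => fwdX q s (j + (i : ℕ)) fun k => f i * T.contents q k) *
        idem q s j n T =
      idem q s (j + m) n T *
        prodLeft (fun i : Fin m => fwdX q s (j + (i : ℕ)) fun k => f i * T.contents q k) := by
  induction m with
  | zero => simpa using H.idem_mul_idem hq0 hq hj (by omega) T
  | succ m ih =>
    have ih := ih (f := fun i => f i.castSucc) (by omega) fun i k => hf _ _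
    have h := H.idem_mul_fwdX hq0 hq (j := j + m) (by omega) (by omega) T fun i =>
      hf (Fin.last m) i
    rw [prodLeft_succ, ← add_assoc, ← mul_assoc]
    simp only [Fin.val_last, Fin.val_castSucc]
    rw [← h]
    simp only [mul_assoc] at ih ⊢
    rw [ih]

theorem idem_mul_crossMP (hq0 : q ≠ 0) (hq : ∀ k : ℕ, 0 < k → q ^ k ≠ 1) (hj : 1 ≤ j)
    (hN : j + m + n ≤ N + 1) (T : StandardTableau n) {z : ℂ} {u : Fin m → ℂ}
    (hu : ∀ i k, u i / z / T.contents q k ≠ 1) :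
    idem q s j n T * crossMP q s j (fun k => z * T.contents q k) u * idem q s (j + m) n T =
      idem q s j n T * crossMP q s j (fun k => z * T.contents q k) u := by
  induction m with
  | zero => simpa [crossMP] using H.idem_mul_idem hq0 hq hj (by omega) T
  | succ m ih =>
    have ih := ih (u := fun i => u i.castSucc) (by omega) fun i k => hu _ _
    have h := H.idem_mul_prodLeft_bax hq0 hq (j := j + m) (by omega) (by omega) T fun i =>
      hu (Fin.last m) i
    simp only [div_div] at h
    rw [H.crossMP_succ_right, ← add_assoc, ← mul_assoc (idem q s j n T), ← ih]
    simp only [mul_assoc] at h ⊢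
    rw [h]

/-- The projected fused reflection equation for a local solution of the reflection equation. -/
theorem projected_fused_reflection (hs : ∀ i, N ≤ i → s i = 0) (hq0 : q ≠ 0)
    (hq : ∀ k : ℕ, 0 < k → q ^ k ≠ 1) (T : StandardTableau m) (T' : StandardTableau n)
    (hj : 1 ≤ j) (hN : j + m + n ≤ N + 1) {x z : ℂ} (hz : z ≠ 0)
    (hBx : RegularB q j T x) (hBz : RegularB q j T' z) (hY : RegularY q T T' x z)
    {D : Set ℂ} {t : ℂ → R} (ht : IsReflectionSolution q N s D t)
    (hD : ∀ i, x * T.contents q i ∈ D) (hD' : ∀ k, z * T'.contents q k ∈ D) :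
    projYmp q s j T' T (x / z) * projB q s t j T x *
        projYpp q s j T T' (x * z) * projB q s t j T' z =
      projB q s t j T' z * projYpp q s j T' T (x * z) *
        projB q s t j T x * projYpm q s j T T' (x / z) := by
  have hc0 : ∀ k, T'.contents q k ≠ 0 := fun k => quantumContent_ne_zero hq0 _
  -- Locality is assumed only for i < N; beyond that range the generators are 0.
  have hloc : ∀ y ∈ D, ∀ i, 2 ≤ i → Commute (t y) (s i) := fun y hy i hi => by
    rcases Nat.lt_or_ge i N with h | h
    · exact ht.isLocal y hy i hi h
    · rw [hs i h]; exact Commute.zero_right _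
  set u : Fin m → ℂ := fun i => x * T.contents q i with hu
  set v : Fin n → ℂ := fun k => z * T'.contents q k with hv
  have hv0 : ∀ k, v k ≠ 0 := fun k => mul_ne_zero hz (hc0 k)
  have hdiv : ∀ i k, u i / v k = x / z * T.contents q i / T'.contents q k := fun i k => by
    simp only [hu, hv]; ring
  have hmul : ∀ i k, u i * v k = x * z * T.contents q i * T'.contents q k := fun i k => by
    simp only [hu, hv]; ring
  have h1 : ∀ i k, u i / v k ≠ 1 := fun i k => by rw [hdiv]; exact hY.div i k
  have h2 : ∀ i k, u i * v k ≠ 1 := fun i k => by rw [hmul]; exact hY.mul i k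
  have h3 : ∀ i k, k < i → u i * u k ≠ 1 := fun i k h => by
    rw [show u i * u k = x ^ 2 * T.contents q i * T.contents q k by simp only [hu]; ring]
    exact hBx.pair i k h
  have h4 : ∀ i k, k < i → v i * v k ≠ 1 := fun i k h => by
    rw [show v i * v k = z ^ 2 * T'.contents q i * T'.contents q k by simp only [hv]; ring]
    exact hBz.pair i k h
  have hK : ∀ i l, j < l → Commute (baxTau q s t j (u i)) (s l) := fun i l hl =>
    H.baxTau_commute (hloc _ (hD i)) hj hl
  have hK' : ∀ k l, j < l → Commute (baxTau q s t j (v k)) (s l) := fun k l hl =>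
    H.baxTau_commute (hloc _ (hD' k)) hj hl
  have key := H.blockReflection_reflection (K := baxTau q s t j) hj hN hv0 h1 h2 h3 h4 hK hK'
    fun i k => H.baxTau_reflection (hloc _ (hD i)) (hloc _ (hD' k)) (hv0 k) (h1 i k) (h2 i k)
      (ht.reflection _ (hD i) _ (hD' k) (hv0 k) (h1 i k) (h2 i k)) hj
      (by have := i.2; have := k.2; omega) fun h => ⟨hBx.single h i, hBz.single h k⟩
  have eB : fusedB q s t j (T.contents q) x = blockReflection q s (baxTau q s t j) j u := by
    simp only [fusedB, blockReflection, hu]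
    congr! 5
    ring
  have eB' : fusedB q s t j (T'.contents q) z = blockReflection q s (baxTau q s t j) j v := by
    simp only [fusedB, blockReflection, hv]
    congr! 5
    ring
  have eMP : Ymp q s j (T'.contents q) (T.contents q) (x / z) = crossMP q s j v u := by
    simp only [Ymp, crossMP, hdiv]
  have ePM : Ypm q s j (T.contents q) (T'.contents q) (x / z) = crossPM q s j u v := by
    simp only [Ypm, crossPM, hdiv]
  have ePP : Ypp q s j (T.contents q) (T'.contents q) (x * z) = crossPP q s j u v := by
    simp only [Ypp, crossPP, hmul]
  have ePP' : Ypp q s j (T'.contents q) (T.contents q) (x * z) = crossPP q s j v u := by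
    simp only [Ypp, crossPP, mul_comm (v _), hmul, mul_right_comm _ (T'.contents q _)]
  have aPP : idem q s (j + m) n T' * crossPP q s j u v * idem q s j n T' =
      idem q s (j + m) n T' * crossPP q s j u v := by
    have h := H.idem_mul_prodLeft_fwdX hq0 hq hj hN T' (f := fun i => u i.rev * z)
      (fun i k => by rw [mul_assoc]; exact h2 _ _)
    simpa only [crossPP, hv, mul_assoc] using h
  have aPP' : idem q s (j + n) m T * crossPP q s j v u * idem q s j m T =
      idem q s (j + n) m T * crossPP q s j v u := by
    have h := H.idem_mul_prodLeft_fwdX hq0 hq hj (by omega) T (f := fun i => v i.rev * x)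
      (fun i k => by rw [mul_assoc, mul_comm]; exact h2 _ _)
    simpa only [crossPP, hu, mul_assoc] using h
  have aMP : idem q s (j + n) m T * crossMP q s j v u * idem q s j m T =
      idem q s (j + n) m T * crossMP q s j v u := by
    have e : ∀ i k, x / v i * T.contents q k = u k / v i := fun i k => by
      simp only [hu]; ring
    have h := H.idem_mul_prodLeft_fwdX hq0 hq hj (by omega) T (f := fun i => x / v i)
      (fun i k => by rw [e]; exact h1 _ _)
    simpa only [crossMP, e] using h
  have aMP' : idem q s j n T' * crossMP q s j v u * idem q s (j + m) n T' =
      idem q s j n T' * crossMP q s j v u :=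
    H.idem_mul_crossMP hq0 hq hj hN T' fun i k => by rw [div_div]; exact h1 i k
  have cA : Commute (idem q s j n T') (idem q s (j + n) m T) :=
    .idem_right T fun i _ => .symm (.idem_right T' fun l _ => H.comm_of_ne (by omega))
  have cB : Commute (blockReflection q s (baxTau q s t j) j u) (idem q s (j + m) n T') :=
    .idem_right T' fun i _ => .symm (.blockReflection_right
      (fun l _ => H.comm_of_ne (by omega)) fun l => (hK l _ (by have := l.2; omega)).symm)
  have cB' : Commute (blockReflection q s (baxTau q s t j) j v) (idem q s (j + n) m T) :=
    .idem_right T fun i _ => .symm (.blockReflection_right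
      (fun l _ => H.comm_of_ne (by omega)) fun l => (hK' l _ (by have := l.2; omega)).symm)
  rw [projYmp, projB, projYpp, projB, projYpp, projYpm, eB, eB', eMP, ePM, ePP, ePP']
  set A := idem q s j m T
  set A' := idem q s j n T'
  set E := idem q s (j + n) m T
  set E' := idem q s (j + m) n T'
  set B := blockReflection q s (baxTau q s t j) j u
  set B' := blockReflection q s (baxTau q s t j) j v
  set M := crossMP q s j v u
  set P := crossPP q s j u v
  set P' := crossPP q s j v u
  set Q := crossPM q s j u v
  -- Rows of the crossing absorb A behind E, and columns absorb E' behind A'; A' and E commute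
  -- because their generators are far apart.
  have eM : A' * E * M * A * E' = A' * E * M := by
    calc A' * E * M * A * E' = A' * (E * M * A) * E' := by simp only [mul_assoc]
      _ = A' * E * M * E' := by rw [aMP]; simp only [mul_assoc]
      _ = E * (A' * M * E') := by rw [cA.eq]; simp only [mul_assoc]
      _ = E * A' * M := by rw [aMP']; simp only [mul_assoc]
      _ = A' * E * M := by rw [cA.eq]
  calc A' * E * M * (A * B) * (E' * P) * (A' * B')
      = A' * E * M * A * B * (E' * P * A') * B' := by simp only [mul_assoc]
    _ = A' * E * M * A * (B * E') * P * B' := by rw [aPP]; simp only [mul_assoc]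
    _ = (A' * E * M * A * E') * B * P * B' := by rw [cB.eq]; simp only [mul_assoc]
    _ = A' * E * (M * B * P * B') := by rw [eM]; simp only [mul_assoc]
    _ = A' * (E * B') * P' * B * Q := by rw [key]; simp only [mul_assoc]
    _ = A' * B' * (E * P') * B * Q := by rw [← cB'.eq]; simp only [mul_assoc]
    -- On the right side the rule `aPP'` is used backwards, to create the projector A in front of B.
    _ = _ := by
      conv_lhs => rw [← aPP']
      simp only [mul_assoc]

end IsHeckeFamily

end Projected
end

theorem theorem4p2 (q : ℂ) (hq0 : q ≠ 0) (hq : ∀ k : ℕ, 0 < k → q ^ k ≠ 1)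
    (N : ℕ) {R : Type*} [Ring R] [Algebra ℂ R] (ρ : AffineHecke q N →ₐ[ℂ] R)
    (s : ℕ → R) (hs : s = fun i => ρ (AffineHecke.sigma q N i))
    {m n : ℕ} (T : StandardTableau m) (T' : StandardTableau n)
    (j : ℕ) (hj : 1 ≤ j) (hN : j + m + n ≤ N + 1)
    (x z : ℂ) (hx : x ≠ 0) (hz : z ≠ 0)
    (hBx : RegularB q j T x) (hBz : RegularB q j T' z) (hY : RegularY q T T' x z) :
    -- for the rational boundary element with parameter `ξ`
    (∀ ξ : ℂ,
      (∀ i : Fin m, IsUnit (ρ (AffineHecke.tau q N 1) -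
        algebraMap ℂ R (ξ * (x * T.contents q i)⁻¹))) →
      (∀ k : Fin n, IsUnit (ρ (AffineHecke.tau q N 1) -
        algebraMap ℂ R (ξ * (z * T'.contents q k)⁻¹))) →
      ∀ t : ℂ → R, t = rationalTau ξ (ρ (AffineHecke.tau q N 1)) →
      projYmp q s j T' T (x / z) * projB q s t j T x *
          projYpp q s j T T' (x * z) * projB q s t j T' z =
        projB q s t j T' z * projYpp q s j T' T (x * z) *
          projB q s t j T x * projYpm q s j T T' (x / z)) ∧
    -- for every local solution of the reflection equation
    (∀ (D : Set ℂ) (t : ℂ → R), IsReflectionSolution q N s D t →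
      (∀ i : Fin m, x * T.contents q i ∈ D) → (∀ k : Fin n, z * T'.contents q k ∈ D) →
      projYmp q s j T' T (x / z) * projB q s t j T x *
          projYpp q s j T T' (x * z) * projB q s t j T' z =
        projB q s t j T' z * projYpp q s j T' T (x * z) *
          projB q s t j T x * projYpm q s j T T' (x / z)) := by
  subst hs
  have H := AffineHecke.isHeckeFamily (R := R) hq0 ρ
  have hs0 : ∀ i, N ≤ i → ρ (AffineHecke.sigma q N i) = 0 := fun i hi => by
    simp [AffineHecke.sigma, show ¬ i < N by omega]
  refine ⟨fun ξ h1 h2 t ht => ?_, fun D t ht hD hD' =>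
    H.projected_fused_reflection hs0 hq0 hq T T' hj hN hz hBx hBz hY ht hD hD'⟩
  subst ht
  -- Case 1 is case 2 for the set of nonzero y at which the denominator is invertible.
  exact H.projected_fused_reflection hs0 hq0 hq T T' hj hN hz hBx hBz hY
    (isReflectionSolution_rationalTau hq0 ρ ξ)
    (fun i => ⟨mul_ne_zero hx (quantumContent_ne_zero hq0 _), h1 i⟩)
    (fun k => ⟨mul_ne_zero hz (quantumContent_ne_zero hq0 _), h2 k⟩)
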